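/- A plane binary tree is a rooted plane tree in which every vertex is either a leaf or has two ordered children (an up-child and a down-child); a single vertex is allowed. A tanglegram layout is a triple $(L,R,\sigma)$ of two plane binary trees $L,R$ with the same number of leaves and a perfect matching $\sigma$ between the leaves of $L$ and the leaves of $R$; a switch interchanges the up- and down-subtree at an internal vertex of $L$ or of $R$, the matching edges moving with their endpoints. A tanglegram is an equivalence class of layouts under sequences of switches. Two matching edges cross in a layout if the top-to-bottom order of their endpoints in $L$ is opposite to that in $R$; a tanglegram is planar if it has a layout without crossing matching edges, and non-planar otherwise. For a non-empty set $E$ of matching edges of a layout, let $L'$ be obtained from the smallest subtree of $L$ containing the leaves in $E$, rooted at its vertex closest to the root of $L$, by suppressing all non-root vertices of degree $2$, and let $R'$ be obtained from $R$ in the same way; the tanglegram of the layout $(L',R',E)$ is the subtanglegram induced by $E$, and it is proper if $E\neq\sigma$. A tanglegram is crossing-critical if it is non-planar but all its proper induced subtanglegrams are planar. Let No. 6 be the tanglegram of size $4$ in which both trees are $(((1,2),3),4)$ (leaves numbered from top to bottom) with matching $1\mapsto1,\ 2\mapsto4,\ 3\mapsto3,\ 4\mapsto2$, and let No. 13 be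 the tanglegram of size $4$ in which both trees are $((1,2),(3,4))$ with matching $1\mapsto1,\ 2\mapsto3,\ 3\mapsto2,\ 4\mapsto4$. Theorem. A tanglegram is crossing-critical if and only if it is No. 6 or No. 13. Consequently, a tanglegram is non-planar if and only if it contains No. 6 or No. 13 as an induced subtanglegram. -/

import Mathlib

/-- A plane binary tree: a single leaf, or a root with an up-subtree and a down-subtree. -/
inductive PlaneTree : Type
  | leaf : PlaneTree
  | node (up down : PlaneTree) : PlaneTree

namespace PlaneTree

/-- The leaves of a plane binary tree. A leaf of `node u d` is a leaf of `u` (tagged `Sum.inl`)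
or a leaf of `d` (tagged `Sum.inr`). -/
@[reducible]
def Leaf : PlaneTree → Type
  | leaf => Unit
  | node u d => Leaf u ⊕ Leaf d

instance instDecidableEqLeaf : (t : PlaneTree) → DecidableEq t.Leaf
  | leaf => inferInstanceAs (DecidableEq Unit)
  | node u d =>
    haveI := instDecidableEqLeaf u
    haveI := instDecidableEqLeaf d
    inferInstanceAs (DecidableEq (u.Leaf ⊕ d.Leaf))

/-- `t.Above a b`: the leaf `a` lies strictly above the leaf `b` on the line on which the leaves
of the plane tree `t` are drawn. -/
def Above : (t : PlaneTree) → t.Leaf → t.Leaf → Prop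
  | leaf, _, _ => False
  | node u _, Sum.inl a, Sum.inl b => Above u a b
  | node _ _, Sum.inl _, Sum.inr _ => True
  | node _ _, Sum.inr _, Sum.inl _ => False
  | node _ d, Sum.inr a, Sum.inr b => Above d a b

/-- `Switch t t' f`: the plane tree `t'` arises from `t` by interchanging the up-subtree and the
down-subtree at one internal vertex of `t`, and `f` tells where each leaf of `t` moves. -/
inductive Switch : (t t' : PlaneTree) → t.Leaf ≃ t'.Leaf → Prop
  | root (u d : PlaneTree) :
      Switch (node u d) (node d u) (Equiv.sumComm u.Leaf d.Leaf)
  | up {u u' : PlaneTree} {f : u.Leaf ≃ u'.Leaf} (d : PlaneTree) (h : Switch u u' f) :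
      Switch (node u d) (node u' d) (Equiv.sumCongr f (Equiv.refl d.Leaf))
  | down {d d' : PlaneTree} {f : d.Leaf ≃ d'.Leaf} (u : PlaneTree) (h : Switch d d' f) :
      Switch (node u d) (node u d') (Equiv.sumCongr (Equiv.refl u.Leaf) f)

/-- `Induced t t' f`: the plane tree `t'` is the tree induced in `t` by the set `Set.range f` of
leaves of `t`, and `f` maps each leaf of `t'` to the corresponding leaf of `t`. If all the selected
leaves lie in one of the two subtrees at the root, the induced tree is the one induced in that
subtree (the root is moved down, respectively a vertex of degree two is suppressed); otherwise
the root is kept, over the trees induced in the two subtrees. -/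
inductive Induced : (t t' : PlaneTree) → (t'.Leaf → t.Leaf) → Prop
  | leaf : Induced leaf leaf id
  | up {u t' : PlaneTree} {f : t'.Leaf → u.Leaf} (d : PlaneTree) (h : Induced u t' f) :
      Induced (node u d) t' (fun a => Sum.inl (f a))
  | down {d t' : PlaneTree} {f : t'.Leaf → d.Leaf} (u : PlaneTree) (h : Induced d t' f) :
      Induced (node u d) t' (fun a => Sum.inr (f a))
  | node {u u' d d' : PlaneTree} {f : u'.Leaf → u.Leaf} {g : d'.Leaf → d.Leaf}
      (hu : Induced u u' f) (hd : Induced d d' g) :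
      Induced (node u d) (node u' d') (Sum.map f g)

end PlaneTree

/-- A tanglegram layout `(L, R, σ)`: two plane binary trees and a perfect matching between their
leaves. A matching edge is identified with its endpoint in `L`. -/
structure Layout : Type where
  L : PlaneTree
  R : PlaneTree
  σ : L.Leaf ≃ R.Leaf

namespace Layout

/-- `Switch Λ Λ'`: the layout `Λ'` arises from `Λ` by a switch at one internal vertex of one of
the two trees; the matching edges move with their endpoints. -/
inductive Switch : Layout → Layout → Prop
  | left {L L' : PlaneTree} (R : PlaneTree) (σ : L.Leaf ≃ R.Leaf) {f : L.Leaf ≃ L'.Leaf}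
      (h : PlaneTree.Switch L L' f) : Switch ⟨L, R, σ⟩ ⟨L', R, f.symm.trans σ⟩
  | right (L : PlaneTree) {R R' : PlaneTree} (σ : L.Leaf ≃ R.Leaf) {f : R.Leaf ≃ R'.Leaf}
      (h : PlaneTree.Switch R R' f) : Switch ⟨L, R, σ⟩ ⟨L, R', σ.trans f⟩

/-- The matching edges `e` and `e'` cross: their endpoints are in opposite orders on the two
lines. -/
def Cross (Λ : Layout) (e e' : Λ.L.Leaf) : Prop :=
  (Λ.L.Above e e' ∧ Λ.R.Above (Λ.σ e') (Λ.σ e)) ∨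
    (Λ.L.Above e' e ∧ Λ.R.Above (Λ.σ e) (Λ.σ e'))

/-- `Λ.Induces E Λ'`: the set `E` of matching edges of `Λ` induces the sublayout `Λ'`. -/
def Induces (Λ : Layout) (E : Set Λ.L.Leaf) (Λ' : Layout) : Prop :=
  ∃ (f : Λ'.L.Leaf → Λ.L.Leaf) (g : Λ'.R.Leaf → Λ.R.Leaf),
    PlaneTree.Induced Λ.L Λ'.L f ∧ PlaneTree.Induced Λ.R Λ'.R g ∧
      (∀ e, Λ.σ (f e) = g (Λ'.σ e)) ∧ Set.range f = E

end Layout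

/-- A tanglegram: an equivalence class of layouts, where two layouts are equivalent if a sequence
of switches moves one into the other (a switch can be undone by a switch). -/
def Tanglegram : Type := Quot Layout.Switch

namespace Tanglegram

/-- The tanglegram represented by a layout. -/
def mk (Λ : Layout) : Tanglegram := Quot.mk Layout.Switch Λ

/-- A tanglegram is planar if it has a layout without crossing matching edges. -/
def IsPlanar (T : Tanglegram) : Prop :=
  ∃ Λ : Layout, mk Λ = T ∧ ∀ e e' : Λ.L.Leaf, ¬ Λ.Cross e e'

/-- `S` is an induced subtanglegram of `T`. -/
def IsInducedSub (S T : Tanglegram) : Prop :=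
  ∃ (Λ : Layout) (E : Set Λ.L.Leaf) (Λ' : Layout),
    mk Λ = T ∧ Λ.Induces E Λ' ∧ mk Λ' = S

/-- `S` is a proper induced subtanglegram of `T`: it is induced by a set of matching edges that
does not contain all matching edges. -/
def IsProperInducedSub (S T : Tanglegram) : Prop :=
  ∃ (Λ : Layout) (E : Set Λ.L.Leaf) (Λ' : Layout),
    mk Λ = T ∧ Λ.Induces E Λ' ∧ E ≠ Set.univ ∧ mk Λ' = S

/-- A tanglegram is crossing-critical if it is non-planar, but all its proper induced
subtanglegrams are planar. -/
def IsCrossingCritical (T : Tanglegram) : Prop :=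
  ¬ T.IsPlanar ∧ ∀ S : Tanglegram, S.IsProperInducedSub T → S.IsPlanar

/-- The caterpillar with leaves `1, 2, 3, 4` from top to bottom: `(((1, 2), 3), 4)`. -/
def caterpillar : PlaneTree := .node (.node (.node .leaf .leaf) .leaf) .leaf

/-- The complete binary tree with leaves `1, 2, 3, 4` from top to bottom: `((1, 2), (3, 4))`. -/
def balanced : PlaneTree := .node (.node .leaf .leaf) (.node .leaf .leaf)

/-- Two caterpillars `(((1, 2), 3), 4)`, with matching
`1 ↦ 1`, `2 ↦ 4`, `3 ↦ 3`, `4 ↦ 2`. -/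
def no6 : Tanglegram :=
  mk ⟨caterpillar, caterpillar,
    Equiv.swap (Sum.inl (Sum.inl (Sum.inr ())) : caterpillar.Leaf) (Sum.inr ())⟩

/-- Two complete binary trees `((1, 2), (3, 4))`, with matching
`1 ↦ 1`, `2 ↦ 3`, `3 ↦ 2`, `4 ↦ 4`. -/
def no13 : Tanglegram :=
  mk ⟨balanced, balanced,
    Equiv.swap (Sum.inl (Sum.inr ()) : balanced.Leaf) (Sum.inr (Sum.inl ()))⟩

end Tanglegram

/-! A layout is encoded by two ternary relations on its matching edges, one per tree, recording
which subtrees separate which leaves. These relations determine the layout exactly up to switches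
(`mk_eq_mk_iff`). A drawing without crossings becomes an orientation of the pairs of edges such
that, in both trees, a leaf outside a subtree has all leaves of that subtree on one side
(`isPlanar_mk_iff`). Transitivity need not be required, since such an orientation comes from a plane
embedding anyway (`exists_isIso_above`).

The core is `hasCommonOrder_of_minimal`. Suppose that S is minimal without a common order and
contains neither conflict. Cut S into two blocks. If the right subtrees meeting both blocks form a
chain, the smallest one contains an anchor from each block (`IsTreeRel.exists_anchors`). An order of
the first block with the second anchor at its end and an order of the second block with the first
anchor at its start can then be glued. Cutting at the left root shows that some leaf a is one side
of the left root (`exists_isOuter`); by symmetry some leaf d is one side of the right root. A second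
cut, below a in the left tree, leaves only small configurations, where a or d can be inserted at an
end of an order of the others.

Conversely, each conflict forces contradictory orientations, and drawability passes to induced
layouts. The four edges of a conflict induce No. 6 or No. 13. Hence every non-planar tanglegram has
size at least four, so these two are critical. -/

/-- The laws of the relation `T x y z`, "in a rooted binary tree with leaf set `X`, some subtree
contains the leaves `x` and `y`, but not `z`". -/
structure IsTreeRel {X : Type*} (T : X → X → X → Prop) : Prop where
  symm : ∀ {x y z}, T x y z → T y x z
  irrefl : ∀ {x y}, ¬ T x y x
  refl : ∀ {x z}, x ≠ z → T x x z
  trans : ∀ {x y z w}, T x y z → T y w z → T x w z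
  excl : ∀ {x y z}, T x y z → ¬ T x z y
  total : ∀ {x y z}, x ≠ y → y ≠ z → x ≠ z → T x y z ∨ T x z y ∨ T y z x
  four : ∀ {x y z} w, T x y z → T x y w ∨ T x w z

/-- `Orients T S o`: the relation `o` orients the pairs of elements of `S` in the way in which
some plane embedding of the tree `T` orders its leaves. -/
def Orients {X : Type*} (T : X → X → X → Prop) (S : Set X) (o : X → X → Prop) : Prop :=
  ∀ x ∈ S, ∀ y ∈ S, ∀ z ∈ S, T x y z → (o x z ↔ o y z)

/-- The trees `TL` and `TR` have embeddings that order the leaves in `S` in the same way. -/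
def HasCommonOrder {X : Type*} (TL TR : X → X → X → Prop) (S : Set X) : Prop :=
  ∃ o : X → X → Prop, (∀ x ∈ S, ∀ y ∈ S, x ≠ y → (o x y ↔ ¬ o y x)) ∧
    Orients TL S o ∧ Orients TR S o

/-- The leaves `a`, `b`, `c`, `d` induce the trees `(((a, b), c), d)` and `(((a, d), c), b)`. -/
def CaterpillarConflict {X : Type*} (TL TR : X → X → X → Prop) (a b c d : X) : Prop :=
  TL a b c ∧ TL a c d ∧ TR a d c ∧ TR a c b

/-- The leaves `a`, `b`, `c`, `d` induce the trees `((a, b), (c, d))` and `((a, c), (b, d))`. -/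
def BalancedConflict {X : Type*} (TL TR : X → X → X → Prop) (a b c d : X) : Prop :=
  TL a b c ∧ TL c d a ∧ TR a c b ∧ TR b d a

/-- `a` is the only leaf of one of the two subtrees at the root of the tree induced by `S`. -/
def IsOuter {X : Type*} (T : X → X → X → Prop) (S : Set X) (a : X) : Prop :=
  a ∈ S ∧ ∀ x ∈ S, ∀ y ∈ S, x ≠ a → y ≠ a → T x y a

/-! ### Root splits and smallest mixed subtrees -/

section

variable {X : Type*} {T TL TR : X → X → X → Prop} {S : Set X}

theorem IsTreeRel.ne_right (h : IsTreeRel T) {x y z : X} (hT : T x y z) : x ≠ z := by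
  rintro rfl; exact h.irrefl hT

theorem IsTreeRel.ne_right' (h : IsTreeRel T) {x y z : X} (hT : T x y z) : y ≠ z :=
  h.ne_right (h.symm hT)

theorem IsTreeRel.comp {Y : Type*} (h : IsTreeRel T) {f : Y → X} (hf : f.Injective) :
    IsTreeRel fun x y z => T (f x) (f y) (f z) where
  symm := h.symm
  irrefl := h.irrefl
  refl hne := h.refl (hf.ne hne)
  trans := h.trans
  excl := h.excl
  total h1 h2 h3 := h.total (hf.ne h1) (hf.ne h2) (hf.ne h3)
  four _ := h.four _

/-- The two subtrees at the root of the tree induced by a finite set. -/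
theorem IsTreeRel.exists_split (h : IsTreeRel T) {S : Set X} (hS : S.Finite)
    (hn : S.Nontrivial) :
    ∃ A B : Set X, A.Nonempty ∧ B.Nonempty ∧ A ∪ B = S ∧
      (∀ x ∈ A, ∀ y ∈ A, ∀ z ∈ B, T x y z) ∧ ∀ x ∈ B, ∀ y ∈ B, ∀ z ∈ A, T x y z := by
  induction S, hS using Set.Finite.induction_on with
  | empty => simp at hn
  | @insert w S hw hS ih =>
    rcases S.eq_empty_or_nonempty with rfl | hne
    · simp at hn
    rcases hne.exists_eq_singleton_or_nontrivial with ⟨s, rfl⟩ | hn'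
    · refine ⟨{w}, {s}, by simp, by simp, rfl, ?_, ?_⟩
      · rintro _ rfl _ rfl _ rfl; exact h.refl (by simpa using hw)
      · rintro _ rfl _ rfl _ rfl; exact h.refl (by simpa [eq_comm] using hw)
    obtain ⟨A, B, ⟨a, ha⟩, ⟨b, hb⟩, rfl, hA, hB⟩ := ih hn'
    obtain ⟨hwA, hwB⟩ : w ∉ A ∧ w ∉ B := by simpa using hw
    have hab : a ≠ b := h.ne_right (hA a ha a ha b hb)
    have haw : a ≠ w := by rintro rfl; exact hwA ha
    have hbw : b ≠ w := by rintro rfl; exact hwB hb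
    have key : ∀ x ∈ A, ∀ y ∈ B, T a b w → T x y w := fun x hx y hy hT => by
      have h1 : T a x w := (h.four w (hA a ha x hx b hb)).resolve_right (h.excl hT)
      have h2 : T b y w := (h.four w (hB b hb y hy a ha)).resolve_right (h.excl (h.symm hT))
      exact h.trans (h.symm h1) (h.trans hT h2)
    -- The triple formed by `w` and one representative of each side tells where `w` attaches: above
    -- the old root, on the side of `A`, or on the side of `B`.
    rcases h.total hab hbw haw with hT | hT | hT
    · refine ⟨A ∪ B, {w}, ⟨a, Or.inl ha⟩, by simp, by simp, ?_, ?_⟩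
      · have h1 : ∀ x ∈ A ∪ B, T a x w := by
          rintro x (hx | hx)
          · exact h.trans (key a ha b hb hT) (h.symm (key x hx b hb hT))
          · exact key a ha x hx hT
        rintro x hx y hy _ rfl
        exact h.trans (h.symm (h1 x hx)) (h1 y hy)
      · rintro _ rfl _ rfl z hz
        exact h.refl (by rintro rfl; exact hw hz)
    · have h1 : ∀ x ∈ A, ∀ z ∈ B, T x w z := fun x hx z hz => by
        have h2 : T a w z := by
          refine (h.four z hT).resolve_right fun h3 => ?_
          exact h.excl (h.symm h3) (h.symm (h.symm (hB z hz b hb a ha)))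
        exact h.trans (hA x hx a ha z hz) h2
      refine ⟨insert w A, B, by simp, ⟨b, hb⟩, by rw [Set.insert_union], ?_, ?_⟩
      · rintro x (rfl | hx) y (rfl | hy) z hz
        · exact h.refl (by rintro rfl; exact hwB hz)
        · exact h.symm (h1 y hy z hz)
        · exact h1 x hx z hz
        · exact hA x hx y hy z hz
      · rintro x hx y hy z (rfl | hz)
        · refine (h.four z (hB x hx y hy a ha)).resolve_right fun h3 => ?_
          exact h.excl (h.symm (h1 a ha x hx)) (h.symm h3)
        · exact hB x hx y hy z hz
    · have h1 : ∀ x ∈ B, ∀ z ∈ A, T x w z := fun x hx z hz => by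
        have h2 : T b w z := by
          refine (h.four z hT).resolve_right fun h3 => ?_
          exact h.excl (h.symm h3) (h.symm (h.symm (hA z hz a ha b hb)))
        exact h.trans (hB x hx b hb z hz) h2
      refine ⟨A, insert w B, ⟨a, ha⟩, by simp, by rw [Set.union_insert], ?_, ?_⟩
      · rintro x hx y hy z (rfl | hz)
        · refine (h.four z (hA x hx y hy b hb)).resolve_right fun h3 => ?_
          exact h.excl (h.symm (h1 b hb x hx)) (h.symm h3)
        · exact hA x hx y hy z hz
      · rintro x (rfl | hx) y (rfl | hy) z hz
        · exact h.refl (by rintro rfl; exact hwA hz)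
        · exact h.symm (h1 y hy z hz)
        · exact h1 x hx z hz
        · exact hB x hx y hy z hz

/-- If the subtrees containing elements of both `α` and `β` form a chain, the smallest of them has
an element of `α` and an element of `β` that belong to all of them. -/
theorem IsTreeRel.exists_anchors (h : IsTreeRel T) {α β : Set X} (hα : α.Finite) (hβ : β.Finite)
    (hα' : α.Nonempty) (hβ' : β.Nonempty)
    (hchain : ∀ x ∈ α, ∀ x' ∈ α, ∀ y ∈ β, ∀ y' ∈ β, T x y x' → ¬ T x' y' x) :
    ∃ a ∈ α, ∃ b ∈ β, ∀ x ∈ α, ∀ y ∈ β, ¬ T x y a ∧ ¬ T x y b := by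
  -- The number of leaves in the smallest subtree containing both members of the pair.
  let c : X × X → ℕ := fun p => {w ∈ α ∪ β | ¬ T p.1 p.2 w}.ncard
  obtain ⟨⟨a, b⟩, ⟨ha, hb⟩, hmin⟩ :=
    Set.exists_min_image (α ×ˢ β) c (hα.prod hβ) (hα'.prod hβ')
  simp only at ha hb
  refine ⟨a, ha, b, hb, fun x hx y hy => ?_⟩
  -- If a subtree with `x` and `y` misses an anchor, the chain condition puts `x` into the smallest
  -- subtree of `a` and `b`. The smallest subtree of `x` and `y` is then strictly smaller, against
  -- the choice of the anchors.
  have main : ∀ z, (z = a ∨ z = b) → ¬ T x y z := by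
    intro z hz hT
    refine (hmin (x, y) ⟨hx, hy⟩).not_gt (Set.ncard_lt_ncard ?_ ((hα.union hβ).subset
      (Set.sep_subset _ _)))
    have hz' : z ∈ α ∪ β := by rcases hz with rfl | rfl <;> simp [ha, hb]
    have hself : ¬ T a b z := by
      rcases hz with rfl | rfl
      exacts [h.irrefl, fun h' => h.irrefl (h.symm h')]
    have hx' : ¬ T a b x := by
      intro hT'
      rcases hz with rfl | rfl
      · exact hchain x hx z ha y hy b hb hT hT'
      · refine hchain x hx a ha y hy z hb ?_ hT'
        exact (h.four a hT).resolve_right fun h' => h.excl (h.symm h') hT'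
    refine ⟨fun w hw => ⟨hw.1, fun hT' => hw.2 ?_⟩, fun hsub => (hsub ⟨hz', hself⟩).2 hT⟩
    have hzx : T z x w := by
      rcases hz with rfl | rfl
      · exact (h.four x hT').resolve_left hx'
      · exact (h.four x (h.symm hT')).resolve_left fun h' => hx' (h.symm h')
    exact (h.four w hT).resolve_right (h.excl (h.symm hzx))
  exact ⟨main a (Or.inl rfl), main b (Or.inr rfl)⟩

/-! ### Gluing and extending orders -/

open Classical in
/-- The orientation that puts `α` before all other leaves, and follows `o₁` in `α` and `o₂`
elsewhere. -/
def glueOrder (α : Set X) (o₁ o₂ : X → X → Prop) (x y : X) : Prop :=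
  if x ∈ α then (y ∈ α → o₁ x y) else (y ∉ α ∧ o₂ x y)

theorem glueOrder_antisymm {α β : Set X} {o₁ o₂ : X → X → Prop} (hd : Disjoint α β)
    (h₁ : ∀ x ∈ α, ∀ y ∈ α, x ≠ y → (o₁ x y ↔ ¬ o₁ y x))
    (h₂ : ∀ x ∈ β, ∀ y ∈ β, x ≠ y → (o₂ x y ↔ ¬ o₂ y x)) :
    ∀ x ∈ α ∪ β, ∀ y ∈ α ∪ β, x ≠ y → (glueOrder α o₁ o₂ x y ↔ ¬ glueOrder α o₁ o₂ y x) := by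
  intro x hx y hy hne
  have hd' := Set.disjoint_right.1 hd
  unfold glueOrder
  grind

/-- Triples inside one block are governed by `o₁` or `o₂`, and two leaves of one block lie on the
same side of any leaf of the other. Only subtrees meeting both blocks need the last two hypotheses.
-/
theorem orients_glueOrder {α β : Set X} {o₁ o₂ : X → X → Prop} (hd : Disjoint α β)
    (hsymm : ∀ {x y z}, T x y z → T y x z)
    (h₁ : Orients T α o₁) (h₂ : Orients T β o₂)
    (h₁' : ∀ x ∈ α, ∀ y ∈ β, ∀ w ∈ α, T x y w → ¬ o₁ x w)
    (h₂' : ∀ x ∈ α, ∀ y ∈ β, ∀ w ∈ β, T x y w → o₂ y w) :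
    Orients T (α ∪ β) (glueOrder α o₁ o₂) := by
  intro x hx y hy z hz hT
  have hd' := Set.disjoint_right.1 hd
  have hT' := hsymm hT
  have e1 := h₁ x
  have e2 := h₂ x
  have f1 := h₁' x
  have f2 := h₂' x
  have f3 := h₁' y
  have f4 := h₂' y
  unfold glueOrder
  grind

/-- A subtree meeting both blocks contains both anchors. So `b` can replace its elements of `β` when
it is compared with a leaf of `α`, and `a` those of `α` when it is compared with a leaf of `β`. The
sets `S₁` and `S₂` may contain further leaves that help to force the anchors to the ends. -/
theorem IsTreeRel.orients_glueOrder_of_anchors (h : IsTreeRel T) {α β : Set X}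
    {o₁ o₂ : X → X → Prop} (hd : Disjoint α β) {a b : X}
    (hab : ∀ x ∈ α, ∀ y ∈ β, ¬ T x y a ∧ ¬ T x y b)
    {S₁ S₂ : Set X} (hS₁ : insert b α ⊆ S₁) (hS₂ : insert a β ⊆ S₂)
    (h₁ : Orients T S₁ o₁) (h₂ : Orients T S₂ o₂)
    (h₁' : ∀ x ∈ α, ¬ o₁ b x) (h₂' : ∀ y ∈ β, o₂ a y) :
    Orients T (α ∪ β) (glueOrder α o₁ o₂) := by
  have mem₁ : ∀ x ∈ α, x ∈ S₁ := fun x hx => hS₁ (Or.inr hx)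
  have mem₂ : ∀ x ∈ β, x ∈ S₂ := fun x hx => hS₂ (Or.inr hx)
  refine orients_glueOrder hd h.symm (fun x hx y hy z hz => h₁ x (mem₁ x hx) y (mem₁ y hy) z
    (mem₁ z hz)) (fun x hx y hy z hz => h₂ x (mem₂ x hx) y (mem₂ y hy) z (mem₂ z hz)) ?_ ?_
  · intro x hx y hy w hw hT
    have h3 := (h.four b hT).resolve_left (hab x hx y hy).2
    rw [h₁ x (mem₁ x hx) b (hS₁ (Or.inl rfl)) w (mem₁ w hw) h3]
    exact h₁' w hw
  · intro x hx y hy w hw hT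
    have h3 := (h.four a (h.symm hT)).resolve_left fun h' => (hab x hx y hy).1 (h.symm h')
    rw [h₂ y (mem₂ y hy) a (hS₂ (Or.inl rfl)) w (mem₂ w hw) h3]
    exact h₂' w hw

theorem Orients.reverse (h : IsTreeRel T) {o : X → X → Prop}
    (ho : ∀ x ∈ S, ∀ y ∈ S, x ≠ y → (o x y ↔ ¬ o y x)) (hT : Orients T S o) :
    Orients T S fun x y => o y x := fun x hx y hy z hz hxy => by
  have := hT x hx y hy z hz hxy
  show o z x ↔ o z y
  rw [ho z hz x hx (h.ne_right hxy).symm, ho z hz y hy (h.ne_right' hxy).symm, this]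

theorem HasCommonOrder.swap (h : HasCommonOrder TL TR S) : HasCommonOrder TR TL S := by
  obtain ⟨o, h1, h2, h3⟩ := h
  exact ⟨o, h1, h3, h2⟩

theorem IsOuter.mono {S' : Set X} {a : X} (h : IsOuter T S a) (hS : S' ⊆ S) (ha : a ∈ S') :
    IsOuter T S' a :=
  ⟨ha, fun x hx y hy => h.2 x (hS hx) y (hS hy)⟩

theorem IsOuter.not_left (h : IsTreeRel T) {a x y : X} (ha : IsOuter T S a)
    (hx : x ∈ S) (hxa : x ≠ a) (hy : y ∈ S) : ¬ T a x y := fun hT =>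
  h.excl (ha.2 x hx y hy hxa (h.ne_right hT).symm) (h.symm hT)

/-- A leaf that is a subtree at the root can be put last. -/
theorem HasCommonOrder.exists_last (hL : IsTreeRel TL) (hR : IsTreeRel TR)
    (h : HasCommonOrder TL TR S) {a : X} (ha : IsOuter TL S a) :
    ∃ o : X → X → Prop, (∀ x ∈ S, ∀ y ∈ S, x ≠ y → (o x y ↔ ¬ o y x)) ∧
      Orients TL S o ∧ Orients TR S o ∧ ∀ x ∈ S, x ≠ a → o x a ∧ ¬ o a x := by
  obtain ⟨o, h1, h2, h3⟩ := h
  -- All other leaves lie on the same side of `a`; if it is the wrong side, the order is reversed.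
  by_cases hex : ∃ x ∈ S, x ≠ a ∧ o x a
  · obtain ⟨x₀, hx₀, hne, hx₀a⟩ := hex
    refine ⟨o, h1, h2, h3, fun x hx hxa => ?_⟩
    have hlast : o x a := (h2 x₀ hx₀ x hx a ha.1 (ha.2 x₀ hx₀ x hx hne hxa)).1 hx₀a
    exact ⟨hlast, (h1 x hx a ha.1 hxa).1 hlast⟩
  · push Not at hex
    refine ⟨fun x y => o y x, fun x hx y hy hxy => h1 y hy x hx hxy.symm, h2.reverse hL h1,
      h3.reverse hR h1, fun x hx hxa => ⟨?_, hex x hx hxa⟩⟩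
    exact (h1 a ha.1 x hx hxa.symm).2 (hex x hx hxa)

/-- A leaf that is a subtree at the root can be put first. -/
theorem HasCommonOrder.exists_first (hL : IsTreeRel TL) (hR : IsTreeRel TR)
    (h : HasCommonOrder TL TR S) {a : X} (ha : IsOuter TL S a) :
    ∃ o : X → X → Prop, (∀ x ∈ S, ∀ y ∈ S, x ≠ y → (o x y ↔ ¬ o y x)) ∧
      Orients TL S o ∧ Orients TR S o ∧ ∀ x ∈ S, x ≠ a → o a x ∧ ¬ o x a := by
  obtain ⟨o, h1, h2, h3, h4⟩ := h.exists_last hL hR ha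
  exact ⟨fun x y => o y x, fun x hx y hy hxy => h1 y hy x hx hxy.symm, h2.reverse hL h1,
    h3.reverse hR h1, h4⟩

/-- With `a` in front, the only new constraints come from subtrees containing `a` and some `x` but
not `w`: since `a` precedes `w`, so must `x`. -/
theorem hasCommonOrder_of_insert_first (hL : IsTreeRel TL) (hR : IsTreeRel TR) {a : X}
    (ha : a ∈ S) {o : X → X → Prop}
    (ho : ∀ x ∈ S \ {a}, ∀ y ∈ S \ {a}, x ≠ y → (o x y ↔ ¬ o y x))
    (hoL : Orients TL (S \ {a}) o) (hoR : Orients TR (S \ {a}) o)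
    (hL' : ∀ x ∈ S \ {a}, ∀ w ∈ S \ {a}, TL a x w → o x w)
    (hR' : ∀ x ∈ S \ {a}, ∀ w ∈ S \ {a}, TR a x w → o x w) : HasCommonOrder TL TR S := by
  have hS : S = {a} ∪ S \ {a} := by simp [ha]
  have hd : Disjoint {a} (S \ {a}) := Set.disjoint_sdiff_right
  have key : ∀ T : X → X → X → Prop, IsTreeRel T → Orients T (S \ {a}) o →
      (∀ x ∈ S \ {a}, ∀ w ∈ S \ {a}, T a x w → o x w) →
      Orients T ({a} ∪ S \ {a}) (glueOrder {a} o o) := fun T h ho' h' => by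
    refine orients_glueOrder hd h.symm ?_ ho' ?_ ?_
    · rintro _ rfl _ rfl _ rfl; simp
    · rintro _ rfl y - _ rfl hT; exact absurd hT h.irrefl
    · rintro _ rfl; exact h'
  refine ⟨glueOrder {a} o o, ?_, ?_, ?_⟩
  · rw [hS]
    refine glueOrder_antisymm hd ?_ ho
    rintro _ rfl _ rfl; simp
  · rw [hS]; exact key TL hL hoL hL'
  · rw [hS]; exact key TR hR hoR hR'

theorem hasCommonOrder_of_insert_last (hL : IsTreeRel TL) (hR : IsTreeRel TR) {a : X}
    (ha : a ∈ S) {o : X → X → Prop}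
    (ho : ∀ x ∈ S \ {a}, ∀ y ∈ S \ {a}, x ≠ y → (o x y ↔ ¬ o y x))
    (hoL : Orients TL (S \ {a}) o) (hoR : Orients TR (S \ {a}) o)
    (hL' : ∀ x ∈ S \ {a}, ∀ w ∈ S \ {a}, TL a x w → o w x)
    (hR' : ∀ x ∈ S \ {a}, ∀ w ∈ S \ {a}, TR a x w → o w x) : HasCommonOrder TL TR S :=
  hasCommonOrder_of_insert_first hL hR ha (o := fun x y => o y x)
    (fun x hx y hy hxy => ho y hy x hx hxy.symm) (hoL.reverse hL ho) (hoR.reverse hR ho) hL' hR'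

/-! ### Minimal sets without a common order -/

/-- A minimal set without a common order that contains no conflict splits off
a single leaf. -/
theorem exists_isOuter (hL : IsTreeRel TL) (hR : IsTreeRel TR) (hS : S.Finite)
    (hn : S.Nontrivial) (hno : ¬ HasCommonOrder TL TR S)
    (hmin : ∀ S' ⊂ S, HasCommonOrder TL TR S')
    (hbal : ∀ a ∈ S, ∀ b ∈ S, ∀ c ∈ S, ∀ d ∈ S, ¬ BalancedConflict TL TR a b c d) :
    ∃ a, IsOuter TL S a := by
  obtain ⟨A, B, hA, hB, rfl, hAB, hBA⟩ := hL.exists_split hS hn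
  have hd : Disjoint A B := Set.disjoint_left.2 fun x hx hx' => hL.irrefl (hAB x hx x hx x hx')
  -- Two disjoint right subtrees meeting both sides of the left root would give a balanced conflict.
  obtain ⟨a, ha, b, hb, hab⟩ := hR.exists_anchors (hS.subset Set.subset_union_left)
    (hS.subset Set.subset_union_right) hA hB fun x hx x' hx' y hy y' hy' h1 h2 =>
      hbal x (Or.inl hx) x' (Or.inl hx') y (Or.inr hy) y' (Or.inr hy')
        ⟨hAB x hx x' hx' y hy, hBA y hy y' hy' x hx, h1, h2⟩
  have hbA : b ∉ A := Set.disjoint_right.1 hd hb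
  have haB : a ∉ B := Set.disjoint_left.1 hd ha
  have hout₁ : IsOuter TL (insert b A) b := by
    refine ⟨Or.inl rfl, fun x hx y hy hxb hyb => hAB x (hx.resolve_left hxb) y
      (hy.resolve_left hyb) b hb⟩
  have hout₂ : IsOuter TL (insert a B) a := by
    refine ⟨Or.inl rfl, fun x hx y hy hxb hyb => hBA x (hx.resolve_left hxb) y
      (hy.resolve_left hyb) a ha⟩
  have hsub₁ : insert b A ⊆ A ∪ B := Set.insert_subset (Or.inr hb) Set.subset_union_left
  have hsub₂ : insert a B ⊆ A ∪ B := Set.insert_subset (Or.inl ha) Set.subset_union_right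
  -- If a block together with the foreign anchor is everything, the other block is that anchor
  -- alone.
  by_cases h₁ : insert b A = A ∪ B
  · exact ⟨b, h₁ ▸ hout₁⟩
  by_cases h₂ : insert a B = A ∪ B
  · exact ⟨a, h₂ ▸ hout₂⟩
  obtain ⟨o₁, p₁, q₁, r₁, s₁⟩ :=
    (hmin _ (hsub₁.ssubset_of_ne h₁)).exists_last hL hR hout₁
  obtain ⟨o₂, p₂, q₂, r₂, s₂⟩ :=
    (hmin _ (hsub₂.ssubset_of_ne h₂)).exists_first hL hR hout₂
  refine absurd ⟨glueOrder A o₁ o₂, ?_, ?_, ?_⟩ hno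
  · exact glueOrder_antisymm hd (fun x hx y hy => p₁ x (Or.inr hx) y (Or.inr hy))
      fun x hx y hy => p₂ x (Or.inr hx) y (Or.inr hy)
  · refine orients_glueOrder hd hL.symm
      (fun x hx y hy z hz => q₁ x (Or.inr hx) y (Or.inr hy) z (Or.inr hz))
      (fun x hx y hy z hz => q₂ x (Or.inr hx) y (Or.inr hy) z (Or.inr hz)) ?_ ?_
    · exact fun x hx y hy w hw hT => absurd hT (hL.excl (hAB x hx w hw y hy))
    · exact fun x hx y hy w hw hT => absurd (hL.symm hT) (hL.excl (hBA y hy w hw x hx))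
  · refine hR.orients_glueOrder_of_anchors hd hab subset_rfl subset_rfl r₁ r₂ ?_ ?_
    · exact fun x hx => (s₁ x (Or.inr hx) (by rintro rfl; exact hbA hx)).2
    · exact fun y hy => (s₂ y (Or.inr hy) (by rintro rfl; exact haB hy)).1

/-- A minimal set without a common order contains one of the two conflicts. -/
theorem hasCommonOrder_of_minimal (hL : IsTreeRel TL) (hR : IsTreeRel TR) (hS : S.Finite)
    (hmin : ∀ S' ⊂ S, HasCommonOrder TL TR S')
    (hcat : ∀ a ∈ S, ∀ b ∈ S, ∀ c ∈ S, ∀ d ∈ S, ¬ CaterpillarConflict TL TR a b c d)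
    (hbal : ∀ a ∈ S, ∀ b ∈ S, ∀ c ∈ S, ∀ d ∈ S, ¬ BalancedConflict TL TR a b c d) :
    HasCommonOrder TL TR S := by
  by_contra hno
  have hdiff : ∀ {x}, x ∈ S → S \ {x} ⊂ S := fun hx => Set.sdiff_singleton_ssubset.2 hx
  have hn : S.Nontrivial := by
    by_contra hn
    rw [Set.not_nontrivial_iff] at hn
    refine hno ⟨fun _ _ => True, fun x hx y hy hxy => absurd (hn hx hy) hxy, ?_, ?_⟩ <;>
      exact fun x hx y hy z hz _ => Iff.rfl
  obtain ⟨a, ha⟩ := exists_isOuter hL hR hS hn hno hmin hbal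
  obtain ⟨d, hd⟩ := exists_isOuter hR hL hS hn (fun h => hno h.swap) (fun S' h => (hmin S' h).swap)
    fun a ha b hb c hc d hd h => hbal a ha c hc b hb d hd ⟨h.2.2.1, h.2.2.2, h.1, h.2.1⟩
  -- A leaf outer in both trees can be put in front of any common order of the others.
  have hne : a ≠ d := by
    rintro rfl
    obtain ⟨o, h1, h2, h3⟩ := hmin _ (hdiff ha.1)
    exact hno (hasCommonOrder_of_insert_first hL hR ha.1 h1 h2 h3
      (fun x hx w hw hT => absurd hT (ha.not_left hL hx.1 hx.2 hw.1))
      fun x hx w hw hT => absurd hT (hd.not_left hR hx.1 hx.2 hw.1))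
  have hdS : d ∈ S \ {a} := ⟨hd.1, hne.symm⟩
  have haS : a ∈ S \ {d} := ⟨ha.1, hne⟩
  -- Since `d` is outer in the right tree, all other leaves lie on the same side of it as `a`. An
  -- order starting with `a` therefore ends with `d`.
  have firstLast : ∀ S' ⊂ S, a ∈ S' → ∃ o : X → X → Prop,
      (∀ x ∈ S', ∀ y ∈ S', x ≠ y → (o x y ↔ ¬ o y x)) ∧ Orients TL S' o ∧ Orients TR S' o ∧
      (∀ x ∈ S', x ≠ a → o a x ∧ ¬ o x a) ∧
      (d ∈ S' → ∀ x ∈ S', x ≠ d → o x d ∧ ¬ o d x) := by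
    intro S' hS' haS'
    obtain ⟨o, h1, h2, h3, h4⟩ := (hmin S' hS').exists_first hL hR (ha.mono hS'.subset haS')
    refine ⟨o, h1, h2, h3, h4, fun hdS' x hx hxd => ?_⟩
    have : o x d := (h3 x hx a haS' d hdS'
      (hd.2 x (hS'.subset hx) a ha.1 hxd hne)).2 (h4 d hdS' hne.symm).1
    exact ⟨this, (h1 x hx d hdS' hxd).1 this⟩
  by_cases hnt : (S \ {a}).Nontrivial
  swap
  · rw [Set.not_nontrivial_iff] at hnt
    have hx : ∀ x ∈ S \ {d}, x = a := fun x hx => by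
      by_contra hxa
      exact hx.2 (hnt ⟨hx.1, hxa⟩ hdS)
    obtain ⟨o, h1, h2, h3⟩ := hmin _ (hdiff hd.1)
    refine hno (hasCommonOrder_of_insert_last hL hR hd.1 h1 h2 h3 ?_ ?_)
    · intro x hx' w hw hT
      rw [hx x hx', hx w hw] at hT
      exact absurd (hL.symm hT) hL.irrefl
    · intro x hx' w hw hT
      rw [hx x hx', hx w hw] at hT
      exact absurd (hR.symm hT) hR.irrefl
  obtain ⟨P, β, hP, hβ, hPβ, hPP, hββ, hdβ⟩ : ∃ P β : Set X, P.Nonempty ∧ β.Nonempty ∧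
      P ∪ β = S \ {a} ∧ (∀ x ∈ P, ∀ y ∈ P, ∀ z ∈ β, TL x y z) ∧
      (∀ x ∈ β, ∀ y ∈ β, ∀ z ∈ P, TL x y z) ∧ d ∈ β := by
    obtain ⟨A, B, hA, hB, hAB, h1, h2⟩ := hL.exists_split (hS.subset Set.sdiff_subset) hnt
    rcases hAB ▸ hdS with h | h
    · exact ⟨B, A, hB, hA, by rw [Set.union_comm, hAB], h2, h1, h⟩
    · exact ⟨A, B, hA, hB, hAB, h1, h2, h⟩
  have hdPβ : Disjoint P β := Set.disjoint_left.2 fun x hx hx' => hL.irrefl (hPP x hx x hx x hx')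
  have hPS : ∀ x ∈ P, x ∈ S ∧ x ≠ a := fun x hx =>
    hPβ.subset (Or.inl hx)
  have hβS : ∀ x ∈ β, x ∈ S ∧ x ≠ a := fun x hx =>
    hPβ.subset (Or.inr hx)
  have hcases : ∀ x ∈ S, x = a ∨ x ∈ P ∨ x ∈ β := fun x hx => by
    by_cases hxa : x = a
    · exact Or.inl hxa
    · exact Or.inr (hPβ.superset ⟨hx, hxa⟩)
  have hPd : ∀ x ∈ P, x ≠ d := by rintro x hx rfl; exact Set.disjoint_left.1 hdPβ hx hdβ
  -- If `β` is just `d`, then `a` is the only leaf that a left subtree with `d` and another leaf can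
  -- miss. So `d` can be appended to an order starting with `a`.
  by_cases hQ : ∃ q ∈ β, q ≠ d
  swap
  · push Not at hQ
    obtain ⟨o, h1, h2, h3, h4, -⟩ := firstLast _ (hdiff hd.1) haS
    refine hno (hasCommonOrder_of_insert_last hL hR hd.1 h1 h2 h3 ?_ ?_)
    · intro x hx w hw hT
      rcases hcases w hw.1 with rfl | hwP | hwβ
      · exact (h4 x hx (hL.ne_right' hT)).1
      · rcases hcases x hx.1 with rfl | hxP | hxβ
        · exact absurd (hL.symm hT) (ha.not_left hL hd.1 hne.symm hw.1)
        · exact absurd (hL.symm hT) (hL.excl (hPP x hxP w hwP d hdβ))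
        · exact absurd (hQ x hxβ) hx.2
      · exact absurd (hQ w hwβ) hw.2
    · exact fun x hx w hw hT => absurd hT (hd.not_left hR hx.1 hx.2 hw.1)
  obtain ⟨q₀, hq₀, hq₀d⟩ := hQ
  have hstar : ∀ q ∈ β, q ≠ d → ∀ p ∈ P, ¬ TR a q p := fun q hq hqd p hp hT =>
    -- The left tree induces `(((q, d), p), a)` and the right tree would induce `(((q, a), p), d)`.
    hcat q (hβS q hq).1 d hd.1 p (hPS p hp).1 a ha.1
      ⟨hββ q hq d hdβ p hp, ha.2 q (hβS q hq).1 p (hPS p hp).1 (hβS q hq).2 (hPS p hp).2,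
        hR.symm hT, hd.2 q (hβS q hq).1 p (hPS p hp).1 hqd (hPd p hp)⟩
  have hstar' : ∀ q ∈ β, ∀ p ∈ P, ¬ TR a q p := fun q hq p hp hT => by
    by_cases hqd : q = d
    · subst hqd
      exact hd.not_left hR ha.1 hne (hPS p hp).1 (hR.symm hT)
    · exact hstar q hq hqd p hp hT
  -- Reduction to the case in which the leaf `p` or the cherry `(q, d)` splits off.
  have hsmall : (∃ p, P = {p}) ∨ ∃ q, β = {q, d} := by
    have hdα : Disjoint (insert a P) β := Set.disjoint_insert_left.2
      ⟨fun h => (hβS a h).2 rfl, hdPβ⟩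
    have hαS : insert a P ⊆ S := Set.insert_subset ha.1 fun x hx => (hPS x hx).1
    have hβS' : β ⊆ S := fun x hx => (hβS x hx).1
    have hunion : insert a P ∪ β = S := by
      rw [Set.insert_union, hPβ]; simp [ha.1]
    -- The blocks are `P` with `a`, and `β`. Disjoint mixed right subtrees are excluded by `hstar'`
    -- if one contains `a`, and by the balanced conflict otherwise.
    obtain ⟨z', hz', z, hz, hanch⟩ := hR.exists_anchors (hS.subset hαS) (hS.subset hβS')
      ⟨a, Or.inl rfl⟩ hβ (by
        rintro x (rfl | hx) x' (rfl | hx') y hy y' hy' h1 h2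
        · exact hR.irrefl h1
        · exact hstar' y hy x' hx' h1
        · exact hstar' y' hy' x hx h2
        · exact hbal x (hPS x hx).1 x' (hPS x' hx').1 y (hβS y hy).1 y' (hβS y' hy').1
            ⟨hPP x hx x' hx' y hy, hββ y hy y' hy' x hx, h1, h2⟩)
    have hzd : z ≠ d := by
      rintro rfl
      exact (hanch a (Or.inl rfl) q₀ hq₀).2 (hd.2 a ha.1 q₀ (hβS q₀ hq₀).1 hne hq₀d)
    -- Both sets contain `a` and `d`, so their orders can start with `a` and end with `d`. As the
    -- left tree separates `β` from `P`, every leaf of `β` lies on the same side of a leaf of `P` as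
    -- `d`; this places both anchors correctly.
    have hsub₁ : insert z (insert d (insert a P)) ⊆ S :=
      Set.insert_subset (hβS z hz).1 (Set.insert_subset hd.1 hαS)
    have hsub₂ : insert z' (insert a β) ⊆ S :=
      Set.insert_subset (hαS hz') (Set.insert_subset ha.1 hβS')
    by_cases h₁ : insert z (insert d (insert a P)) = S
    · refine Or.inr ⟨z, Set.Subset.antisymm (fun x hx => ?_)
        (Set.insert_subset hz (by simpa using hdβ))⟩
      rcases h₁.symm ▸ hβS' hx with h | h | h
      · exact Or.inl h
      · exact Or.inr h
      · exact absurd hx (Set.disjoint_left.1 hdα h)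
    by_cases h₂ : insert z' (insert a β) = S
    · have : P ⊆ {z'} := fun x hx => by
        rcases h₂.symm ▸ (hPS x hx).1 with h | h | h
        · exact h
        · exact absurd h (hPS x hx).2
        · exact absurd h (Set.disjoint_left.1 hdPβ hx)
      exact Or.inl ⟨z', (hP.subset_singleton_iff).1 this⟩
    obtain ⟨o₁, p₁, q₁, r₁, s₁, t₁⟩ := firstLast _ (hsub₁.ssubset_of_ne h₁) (by simp)
    obtain ⟨o₂, p₂, q₂, r₂, s₂, t₂⟩ := firstLast _ (hsub₂.ssubset_of_ne h₂) (by simp)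
    have m₁ : ∀ {x}, x ∈ insert a P → x ∈ insert z (insert d (insert a P)) :=
      fun h => Or.inr (Or.inr h)
    have m₂ : ∀ {x}, x ∈ β → x ∈ insert z' (insert a β) := fun h => Or.inr (Or.inr h)
    refine absurd ⟨glueOrder (insert a P) o₁ o₂, ?_, ?_, ?_⟩ hno
    · rw [← hunion]
      exact glueOrder_antisymm hdα (fun x hx y hy => p₁ x (m₁ hx) y (m₁ hy))
        fun x hx y hy => p₂ x (m₂ hx) y (m₂ hy)
    · rw [← hunion]
      refine orients_glueOrder hdα hL.symm
        (fun x hx y hy z hz => q₁ x (m₁ hx) y (m₁ hy) z (m₁ hz))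
        (fun x hx y hy z hz => q₂ x (m₂ hx) y (m₂ hy) z (m₂ hz)) ?_ ?_
      · rintro x (rfl | hx) y hy w hw hT
        · exact absurd hT (ha.not_left hL (hβS y hy).1 (hβS y hy).2 (hαS hw))
        · rcases hw with rfl | hw
          · exact (s₁ x (m₁ (Or.inr hx)) (hPS x hx).2).2
          · exact absurd hT (hL.excl (hPP x hx w hw y hy))
      · rintro x (rfl | hx) y hy w hw hT
        · exact absurd hT (ha.not_left hL (hβS y hy).1 (hβS y hy).2 (hβS w hw).1)
        · exact absurd (hL.symm hT) (hL.excl (hββ y hy w hw x hx))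
    · rw [← hunion]
      refine hR.orients_glueOrder_of_anchors hdα hanch
        (Set.insert_subset (by simp) fun x hx => m₁ hx)
        (Set.insert_subset (by simp) fun x hx => m₂ hx) r₁ r₂ ?_ ?_
      · rintro x (rfl | hx)
        · exact (s₁ z (by simp) (hβS z hz).2).1 |> fun h => (p₁ _ (by simp) _ (by simp)
            (hβS z hz).2.symm).1 h
        · rw [q₁ z (by simp) d (by simp) x (m₁ (Or.inr hx)) (hββ z hz d hdβ x hx)]
          exact (t₁ (by simp) x (m₁ (Or.inr hx)) (hPd x hx)).2
      · intro y hy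
        rcases hz' with rfl | hz'
        · exact (s₂ y (m₂ hy) (hβS y hy).2).1
        · have hyz : y ≠ z' := by rintro rfl; exact Set.disjoint_left.1 hdPβ hz' hy
          rw [p₂ z' (by simp) y (m₂ hy) hyz.symm,
            q₂ y (m₂ hy) d (m₂ hdβ) z' (by simp) (hββ y hy d hdβ z' hz')]
          exact (t₂ (m₂ hdβ) z' (by simp) (hPd z' hz')).2
  rcases hsmall with ⟨p, rfl⟩ | ⟨q, rfl⟩
  -- Every right subtree containing `a` and another leaf contains `p`. So `a` can be put in front of
  -- an order of the others that starts with `p`.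
  · have hpS := hPS p rfl
    have hpa : ∀ x ∈ S, x ≠ a → x ≠ p → ¬ TR a x p := fun x hx hxa hxp hT => by
      rcases hcases x hx with h | h | h
      exacts [hxa h, hxp h, hstar' x h p rfl hT]
    have hout : IsOuter TL (S \ {a}) p := by
      refine ⟨hpS, fun x hx y hy hxp hyp => ?_⟩
      rw [← hPβ] at hx hy
      exact hββ x (hx.resolve_left hxp) y (hy.resolve_left hyp) p rfl
    obtain ⟨o, h1, h2, h3, h4⟩ := (hmin _ (hdiff ha.1)).exists_first hL hR hout
    refine hno (hasCommonOrder_of_insert_first hL hR ha.1 h1 h2 h3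
      (fun x hx w hw hT => absurd hT (ha.not_left hL hx.1 hx.2 hw.1)) ?_)
    intro x hx w hw hT
    by_cases hxp : x = p
    · subst hxp
      exact (h4 w hw (hR.ne_right' hT).symm).1
    · have hwp : w ≠ p := by rintro rfl; exact hpa x hx.1 hx.2 hxp hT
      have h5 : TR x p w :=
        ((hR.four p (hR.symm hT)).resolve_left fun h => hpa x hx.1 hx.2 hxp (hR.symm h))
      exact (h3 x hx p hpS w hw h5).2 (h4 w hw hwp).1
  · have hqd : q ≠ d := by
      rcases hq₀ with rfl | h
      exacts [hq₀d, absurd h hq₀d]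
    have hqS := hβS q (by simp)
    have hqS' : q ∈ S \ {d} := ⟨hqS.1, hqd⟩
    -- If so, an order starting with `a` has `p` before `q`, hence by the left tree all of `P`
    -- before `q`, and `d` can follow at the end. Otherwise all leaves except `a` and `d` are joined
    -- to `q` by right subtrees missing `a`, and `a` can be put in front of an order ending with
    -- `d`.
    by_cases hex : ∃ p ∈ P, TR a p q
    · obtain ⟨p, hp, hpq⟩ := hex
      have hpS : p ∈ S \ {d} := ⟨(hPS p hp).1, hPd p hp⟩
      obtain ⟨o, h1, h2, h3, h4, -⟩ := firstLast _ (hdiff hd.1) haS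
      have h5 : o p q := (h3 a haS p hpS q hqS' hpq).1 (h4 q hqS' hqS.2).1
      refine hno (hasCommonOrder_of_insert_last hL hR hd.1 h1 h2 h3 ?_
        fun x hx w hw hT => absurd hT (hd.not_left hR hx.1 hx.2 hw.1))
      intro x hx w hw hT
      rcases hcases x hx.1 with rfl | hxP | hxq | hxd
      · exact absurd (hL.symm hT) (ha.not_left hL hd.1 hne.symm hw.1)
      · rcases hcases w hw.1 with rfl | hwP | hwq
        · exact (h4 x hx (hPS x hxP).2).1
        · exact absurd (hL.symm hT) (hL.excl (hPP x hxP w hwP d hdβ))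
        · exact absurd hT (hL.excl (hββ d hdβ w hwq x hxP))
      · subst hxq
        rcases hcases w hw.1 with rfl | hwP | hwq | hwd
        · exact (h4 x hx hqS.2).1
        · exact (h2 p hpS w hw x hx (hPP p hp w hwP x (by simp))).1 h5
        · subst hwq; exact absurd (hL.symm hT) hL.irrefl
        · exact absurd hwd hw.2
      · exact absurd hxd hx.2
    · push Not at hex
      have hpq : ∀ p ∈ P, TR p q a := fun p hp => by
        have hpq : p ≠ q := by rintro rfl; exact Set.disjoint_left.1 hdPβ hp (by simp)
        rcases hR.total (hPS p hp).2.symm hpq hqS.2.symm with h | h | h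
        exacts [absurd h (hex p hp), absurd h (hstar' q (by simp) p hp), h]
      have hqx : ∀ x ∈ S, x ≠ a → x ≠ d → TR x q a := fun x hx hxa hxd => by
        rcases hcases x hx with h | h | h | h
        exacts [absurd h hxa, hpq x h, h.symm ▸ hR.refl hqS.2, absurd h hxd]
      obtain ⟨o, h1, h2, h3, h4⟩ := (hmin _ (hdiff ha.1)).swap.exists_last hR hL
        (hd.mono Set.sdiff_subset hdS)
      refine hno (hasCommonOrder_of_insert_first hL hR ha.1 h1 h3 h2
        (fun x hx w hw hT => absurd hT (ha.not_left hL hx.1 hx.2 hw.1)) ?_)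
      intro x hx w hw hT
      by_cases hwd : w = d
      · subst hwd
        exact (h4 x hx (hR.ne_right' hT)).1
      · have hxd : x ≠ d := by
          rintro rfl
          exact hd.not_left hR ha.1 hne hw.1 (hR.symm hT)
        exact absurd (hR.symm hT)
          (hR.excl (hR.trans (hqx x hx.1 hx.2 hxd) (hR.symm (hqx w hw.1 hw.2 hwd))))

/-- A finite set of leaves has a common order in two trees unless they contain one of the two
conflicts. -/
theorem hasCommonOrder_or_conflict [Finite X] (hL : IsTreeRel TL) (hR : IsTreeRel TR) (S : Set X) :
    HasCommonOrder TL TR S ∨ ∃ a b c d,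
      CaterpillarConflict TL TR a b c d ∨ BalancedConflict TL TR a b c d := by
  by_contra! h
  obtain ⟨hno, hconf⟩ := h
  refine hno ?_
  clear hno
  refine wellFounded_lt.induction (C := fun S => HasCommonOrder TL TR S) S fun S ih => ?_
  exact hasCommonOrder_of_minimal hL hR S.toFinite ih
    (fun a _ b _ c _ d _ => (hconf a b c d).1) fun a _ b _ c _ d _ => (hconf a b c d).2

/-! ### The conflicts as obstructions, and transport of orders -/

/-- The left tree puts `d` at an end and the right tree puts `b` at an end, so `c` lies between
them. But `a b c` and `a d c` put `b` and `d` on the same side of `c`. -/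
theorem CaterpillarConflict.not_hasCommonOrder (hL : IsTreeRel TL) (hR : IsTreeRel TR)
    {a b c d : X} (h : CaterpillarConflict TL TR a b c d) : ¬ HasCommonOrder TL TR Set.univ := by
  rintro ⟨o, h1, h2, h3⟩
  obtain ⟨abc, acd, adc, acb⟩ := h
  simp only [Orients, Set.mem_univ, true_imp_iff] at h1 h2 h3
  have abd : TL a b d := (hL.four d abc).resolve_right (hL.excl acd)
  have adb : TR a d b := (hR.four b adc).resolve_right (hR.excl acb)
  have e1 := h2 _ _ _ abc
  have e2 := h2 _ _ _ acd
  have e3 := h2 _ _ _ abd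
  have e4 := h3 _ _ _ adc
  have e5 := h3 _ _ _ acb
  have e6 := h3 _ _ _ adb
  have e7 := h1 _ _ (hL.ne_right' abd)
  have e8 := h1 _ _ (hL.ne_right' acd)
  have e9 := h1 _ _ (hL.ne_right' abc)
  tauto

/-- Writing `<` for the orientation, `b < c` iff `d < c` iff `d < a` iff `d < b` iff `c < b`, which
is absurd. -/
theorem BalancedConflict.not_hasCommonOrder (hL : IsTreeRel TL) (hR : IsTreeRel TR)
    {a b c d : X} (h : BalancedConflict TL TR a b c d) : ¬ HasCommonOrder TL TR Set.univ := by
  rintro ⟨o, h1, h2, h3⟩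
  obtain ⟨abc, cda, acb, bda⟩ := h
  simp only [Orients, Set.mem_univ, true_imp_iff] at h1 h2 h3
  have abd : TL a b d := (hL.four d abc).resolve_right fun h => hL.excl (hL.symm cda) (hL.symm h)
  have cdb : TL c d b := (hL.four b cda).resolve_right fun h => hL.excl (hL.symm abc) (hL.symm h)
  have acd : TR a c d := (hR.four d acb).resolve_right fun h => hR.excl (hR.symm bda) (hR.symm h)
  have bdc : TR b d c := (hR.four c bda).resolve_right fun h => hR.excl (hR.symm acb) (hR.symm h)
  have e1 := h2 _ _ _ abc
  have e2 := h2 _ _ _ abd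
  have e3 := h2 _ _ _ cdb
  have e4 := h3 _ _ _ acd
  have e5 := h3 _ _ _ bdc
  have e6 := h1 _ _ (hL.ne_right' abc)
  have e7 := h1 _ _ (hL.ne_right' abd)
  have e8 := h1 _ _ (hR.ne_right' acd)
  tauto

/-- Exactly one of the three resolutions of three distinct leaves holds, so preserving resolutions
already means reflecting them. -/
theorem IsTreeRel.iff_of_imp {Y : Type*} {T' : Y → Y → Y → Prop} (h : IsTreeRel T)
    (h' : IsTreeRel T') {f : X → Y} (hf : ∀ x y z, T x y z → T' (f x) (f y) (f z))
    (x y z : X) : T' (f x) (f y) (f z) ↔ T x y z := by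
  refine ⟨fun hT => ?_, hf x y z⟩
  have hxz : x ≠ z := fun h => h'.ne_right hT (congrArg f h)
  have hyz : y ≠ z := fun h => h'.ne_right' hT (congrArg f h)
  rcases eq_or_ne x y with rfl | hxy
  · exact h.refl hxz
  · rcases h.total hxy hyz hxz with hT' | hT' | hT'
    · exact hT'
    · exact absurd (hf _ _ _ hT') (h'.excl hT)
    · exact absurd (hf _ _ _ hT') fun h => h'.excl (h'.symm hT) h

theorem HasCommonOrder.comap {Y : Type*} {TL' TR' : Y → Y → Y → Prop} {f : X → Y}
    (hf : f.Injective) (hL : ∀ x y z, TL' (f x) (f y) (f z) ↔ TL x y z)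
    (hR : ∀ x y z, TR' (f x) (f y) (f z) ↔ TR x y z)
    (h : HasCommonOrder TL' TR' Set.univ) : HasCommonOrder TL TR Set.univ := by
  obtain ⟨o, h1, h2, h3⟩ := h
  exact ⟨fun x y => o (f x) (f y), fun x _ y _ hxy => h1 _ trivial _ trivial (hf.ne hxy),
    fun x _ y _ z _ hT => h2 _ trivial _ trivial _ trivial ((hL x y z).2 hT),
    fun x _ y _ z _ hT => h3 _ trivial _ trivial _ trivial ((hR x y z).2 hT)⟩

end

/-! ### Plane trees as tree relations -/

namespace PlaneTree

/-- `t.Triple x y z`: some subtree of `t` contains the leaves `x` and `y`, but not the leaf `z`. -/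
def Triple : (t : PlaneTree) → t.Leaf → t.Leaf → t.Leaf → Prop
  | leaf, _, _, _ => False
  | node u _, Sum.inl x, Sum.inl y, Sum.inl z => Triple u x y z
  | node _ _, Sum.inl _, Sum.inl _, Sum.inr _ => True
  | node _ _, Sum.inl _, Sum.inr _, _ => False
  | node _ _, Sum.inr _, Sum.inl _, _ => False
  | node _ _, Sum.inr _, Sum.inr _, Sum.inl _ => True
  | node _ d, Sum.inr x, Sum.inr y, Sum.inr z => Triple d x y z

theorem isTreeRel_triple (t : PlaneTree) : IsTreeRel t.Triple := by
  induction t with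
  | leaf => constructor <;> simp [Triple]
  | node u d hu hd =>
    constructor
    · rintro (x | x) (y | y) (z | z) <;> simp only [Triple, imp_self]
      exacts [hu.symm, hd.symm]
    · rintro (x | x) (y | y) <;> simp only [Triple, not_false_eq_true]
      exacts [hu.irrefl, hd.irrefl]
    · rintro (x | x) (z | z) <;> simp only [Triple, ne_eq, implies_true, Sum.inl.injEq,
        Sum.inr.injEq]
      exacts [hu.refl, hd.refl]
    · rintro (x | x) (y | y) (z | z) (w | w) <;>
        simp only [Triple, imp_self, implies_true, false_imp_iff, imp_false]
      exacts [hu.trans, hd.trans]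
    · rintro (x | x) (y | y) (z | z) <;>
        simp only [Triple, imp_self, not_false_eq_true, not_true_eq_false, implies_true]
      exacts [hu.excl, hd.excl]
    · rintro (x | x) (y | y) (z | z) <;> simp only [Triple, ne_eq, Sum.inl.injEq, Sum.inr.injEq,
        true_or, or_true, implies_true]
      exacts [hu.total, hd.total]
    · rintro (x | x) (y | y) (z | z) (w | w) <;>
        simp only [Triple, imp_self, implies_true, or_true, or_false, false_or, false_imp_iff]
      exacts [hu.four _, hd.four _]

instance instFiniteLeaf : (t : PlaneTree) → Finite t.Leaf
  | leaf => inferInstanceAs (Finite Unit)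
  | node u d =>
    haveI := instFiniteLeaf u
    haveI := instFiniteLeaf d
    inferInstanceAs (Finite (u.Leaf ⊕ d.Leaf))

instance instNonemptyLeaf : (t : PlaneTree) → Nonempty t.Leaf
  | leaf => ⟨()⟩
  | node u _ => (instNonemptyLeaf u).map Sum.inl

theorem above_iff_not_above (t : PlaneTree) {x y : t.Leaf} (h : x ≠ y) :
    t.Above x y ↔ ¬ t.Above y x := by
  induction t with
  | leaf => exact absurd (Subsingleton.elim (α := Unit) x y) h
  | node u d hu hd =>
    rcases x with x | x <;> rcases y with y | y <;> simp only [Above, not_true_eq_false,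
      not_false_eq_true]
    · exact hu fun h' => h (congrArg Sum.inl h')
    · exact hd fun h' => h (congrArg Sum.inr h')

theorem ne_of_above (t : PlaneTree) {x y : t.Leaf} (h : t.Above x y) : x ≠ y := by
  rintro rfl
  induction t with
  | leaf => exact h
  | node u d hu hd =>
    rcases x with x | x
    exacts [hu h, hd h]

theorem orients_above (t : PlaneTree) : Orients t.Triple Set.univ t.Above := by
  rintro x - y - z -
  induction t with
  | leaf => exact False.elim
  | node u d hu hd =>
    rcases x with x | x <;> rcases y with y | y <;> rcases z with z | z <;>
      simp only [Triple, Above, implies_true, false_imp_iff]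
    exacts [hu x y z, hd x y z]

/-! ### Isomorphisms, switches and embeddings -/

/-- The bijection `f` between the leaves of two plane trees is an isomorphism of the underlying
non-plane trees. -/
def IsIso {t t' : PlaneTree} (f : t.Leaf ≃ t'.Leaf) : Prop :=
  ∀ x y z, t'.Triple (f x) (f y) (f z) ↔ t.Triple x y z

theorem IsIso.refl (t : PlaneTree) : IsIso (Equiv.refl t.Leaf) := fun _ _ _ => Iff.rfl

theorem IsIso.symm {t t' : PlaneTree} {f : t.Leaf ≃ t'.Leaf} (h : IsIso f) : IsIso f.symm :=
  fun x y z => by rw [← h]; simp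

theorem IsIso.trans {t t' t'' : PlaneTree} {f : t.Leaf ≃ t'.Leaf} {g : t'.Leaf ≃ t''.Leaf}
    (hf : IsIso f) (hg : IsIso g) : IsIso (f.trans g) :=
  fun _ _ _ => (hg _ _ _).trans (hf _ _ _)

theorem isIso_sumCongr {u u' d d' : PlaneTree} {f : u.Leaf ≃ u'.Leaf} {g : d.Leaf ≃ d'.Leaf}
    (hf : IsIso f) (hg : IsIso g) :
    IsIso (t := node u d) (t' := node u' d') (Equiv.sumCongr f g) := by
  rintro (x | x) (y | y) (z | z) <;> try exact Iff.rfl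
  exacts [hf x y z, hg x y z]

theorem isIso_sumComm (u d : PlaneTree) :
    IsIso (t := node u d) (t' := node d u) (Equiv.sumComm u.Leaf d.Leaf) := by
  rintro (x | x) (y | y) (z | z) <;> exact Iff.rfl

theorem Switch.isIso {t t' : PlaneTree} {f : t.Leaf ≃ t'.Leaf} (h : Switch t t' f) : IsIso f := by
  induction h with
  | root u d => exact isIso_sumComm u d
  | up d _ ih => exact isIso_sumCongr ih (IsIso.refl d)
  | down u _ ih => exact isIso_sumCongr (IsIso.refl u) ih

/-- `Switches t t' f`: a sequence of switches turns `t` into `t'`, moving the leaves by `f`. -/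
inductive Switches : (t t' : PlaneTree) → t.Leaf ≃ t'.Leaf → Prop
  | refl (t : PlaneTree) : Switches t t (Equiv.refl t.Leaf)
  | step {t t' t'' : PlaneTree} {f : t.Leaf ≃ t'.Leaf} {g : t'.Leaf ≃ t''.Leaf}
      (hf : Switches t t' f) (hg : Switch t' t'' g) : Switches t t'' (f.trans g)

theorem Switches.trans {t t' t'' : PlaneTree} {f : t.Leaf ≃ t'.Leaf} {g : t'.Leaf ≃ t''.Leaf}
    (hf : Switches t t' f) (hg : Switches t' t'' g) : Switches t t'' (f.trans g) := by
  induction hg with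
  | refl => exact hf
  | step _ hg ih => rw [← Equiv.trans_assoc]; exact ih.step hg

theorem Switches.up {u u' : PlaneTree} {f : u.Leaf ≃ u'.Leaf} (d : PlaneTree)
    (h : Switches u u' f) :
    Switches (.node u d) (.node u' d) (Equiv.sumCongr f (Equiv.refl d.Leaf)) := by
  induction h with
  | refl => rw [Equiv.sumCongr_refl]; exact Switches.refl (.node _ d)
  | step _ hg ih =>
    have := Switches.step ih (Switch.up d hg)
    rwa [Equiv.sumCongr_trans] at this

theorem Switches.down {d d' : PlaneTree} {f : d.Leaf ≃ d'.Leaf} (u : PlaneTree)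
    (h : Switches d d' f) :
    Switches (.node u d) (.node u d') (Equiv.sumCongr (Equiv.refl u.Leaf) f) := by
  induction h with
  | refl => rw [Equiv.sumCongr_refl]; exact Switches.refl (.node u _)
  | step _ hg ih =>
    have := Switches.step ih (Switch.down u hg)
    rwa [Equiv.sumCongr_trans] at this

theorem Switches.sumCongr {u u' d d' : PlaneTree} {f : u.Leaf ≃ u'.Leaf} {g : d.Leaf ≃ d'.Leaf}
    (hf : Switches u u' f) (hg : Switches d d' g) :
    Switches (.node u d) (.node u' d') (Equiv.sumCongr f g) := by
  have := (hf.up d).trans (hg.down u')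
  rwa [Equiv.sumCongr_trans] at this

theorem exists_eq_sumCongr {α β α' β' : Type} (f : α ⊕ β ≃ α' ⊕ β')
    (hl : ∀ x, (f (Sum.inl x)).isLeft) (hr : ∀ y, (f (Sum.inr y)).isRight) :
    ∃ (g : α ≃ α') (h : β ≃ β'), f = Equiv.sumCongr g h := by
  simp only [Sum.isLeft_iff, Sum.isRight_iff] at hl hr
  choose g hg using hl
  choose h hh using hr
  have hf : ⇑f = Sum.map g h := by ext (x | x) <;> simp [hg, hh]
  have hbij : (Sum.map g h).Bijective := hf ▸ f.bijective
  rw [Sum.map_bijective] at hbij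
  refine ⟨Equiv.ofBijective g hbij.1, Equiv.ofBijective h hbij.2, ?_⟩
  ext (x | x) <;> simp [hg, hh]

/-- No proper subtree contains leaves from both sides of the root. -/
theorem IsIso.isLeft_eq {u d u' d' : PlaneTree} {f : (node u d).Leaf ≃ (node u' d').Leaf}
    (hf : IsIso f) {x y z : (node u d).Leaf} (h : (node u d).Triple x y z) :
    (f x).isLeft = (f y).isLeft := by
  have h' := (hf x y z).2 h
  revert h'
  generalize f x = x', f y = y', f z = z'
  rcases x' with x' | x' <;> rcases y' with y' | y' <;> simp [Triple]

/-- Isomorphic plane trees differ by a sequence of switches. -/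
theorem IsIso.switches {t t' : PlaneTree} {f : t.Leaf ≃ t'.Leaf} (hf : IsIso f) :
    Switches t t' f := by
  induction t generalizing t' with
  | leaf =>
    cases t' with
    | leaf =>
      have : f = Equiv.refl PlaneTree.leaf.Leaf :=
        Equiv.ext fun _ => Subsingleton.elim (α := Unit) _ _
      rw [this]; exact Switches.refl _
    | node u' d' =>
      obtain ⟨x⟩ := instNonemptyLeaf u'
      obtain ⟨y⟩ := instNonemptyLeaf d'
      have : f.symm (Sum.inl x) = f.symm (Sum.inr y) := Subsingleton.elim (α := Unit) _ _
      exact absurd (f.symm.injective this) Sum.inl_ne_inr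
  | node u d hu hd =>
    obtain ⟨x₀⟩ := instNonemptyLeaf u
    obtain ⟨y₀⟩ := instNonemptyLeaf d
    cases t' with
    | leaf =>
      have : f (Sum.inl x₀) = f (Sum.inr y₀) := Subsingleton.elim (α := Unit) _ _
      exact absurd (f.injective this) Sum.inl_ne_inr
    | node u' d' =>
      have hl : ∀ x, (f (Sum.inl x)).isLeft = (f (Sum.inl x₀)).isLeft := fun x =>
        hf.isLeft_eq (z := Sum.inr y₀) trivial
      have hr : ∀ y, (f (Sum.inr y)).isLeft = (f (Sum.inr y₀)).isLeft := fun y =>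
        hf.isLeft_eq (z := Sum.inl x₀) trivial
      obtain ⟨x'⟩ := instNonemptyLeaf u'
      obtain ⟨y'⟩ := instNonemptyLeaf d'
      -- Each half of the source lands in one half of the target; if both landed in the same one,
      -- `f` would not be surjective.
      have hne : (f (Sum.inl x₀)).isLeft ≠ (f (Sum.inr y₀)).isLeft := by
        intro h
        have hall : ∀ w, (f w).isLeft = (f (Sum.inr y₀)).isLeft := by
          rintro (x | y)
          exacts [(hl x).trans h, hr y]
        have h1 := hall (f.symm (Sum.inl x'))
        have h2 := hall (f.symm (Sum.inr y'))
        rw [← h2] at h1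
        simp at h1
      cases hb : (f (Sum.inl x₀)).isLeft with
      | true =>
        rw [hb] at hl hne
        obtain ⟨g, h, rfl⟩ := exists_eq_sumCongr f hl fun y => by
          rw [← Sum.not_isLeft, hr]; simpa using hne.symm
        exact (hu fun x y z => hf (Sum.inl x) (Sum.inl y) (Sum.inl z)).sumCongr
          (hd fun x y z => hf (Sum.inr x) (Sum.inr y) (Sum.inr z))
      | false =>
        rw [hb] at hl hne
        obtain ⟨g, h, hgh⟩ := exists_eq_sumCongr (f.trans (Equiv.sumComm _ _))
          (fun x => by simpa using hl x) fun y => by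
            change (f (Sum.inr y)).swap.isRight = true
            rw [Sum.isRight_swap, hr]; simpa using hne.symm
        have hf' : f = (Equiv.sumCongr g h).trans (Equiv.sumComm _ _) := by
          rw [← hgh]; exact Equiv.ext fun x => (Sum.swap_swap (f x)).symm
        subst hf'
        exact ((hu fun x y z => hf (Sum.inl x) (Sum.inl y) (Sum.inl z)).sumCongr
          (hd fun x y z => hf (Sum.inr x) (Sum.inr y) (Sum.inr z))).step (Switch.root d' u')

/-- Every orientation of the pairs of leaves that respects the subtrees of `t` comes from a plane
embedding of `t`. -/
theorem exists_isIso_above (t : PlaneTree) {o : t.Leaf → t.Leaf → Prop}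
    (ho : ∀ x y, x ≠ y → (o x y ↔ ¬ o y x)) (ht : Orients t.Triple Set.univ o) :
    ∃ (t' : PlaneTree) (f : t.Leaf ≃ t'.Leaf), IsIso f ∧
      ∀ x y, x ≠ y → (t'.Above (f x) (f y) ↔ o x y) := by
  induction t with
  | leaf =>
    exact ⟨leaf, Equiv.refl _, IsIso.refl _,
      fun x y h => absurd (Subsingleton.elim (α := Unit) x y) h⟩
  | node u d hu hd =>
    obtain ⟨u', f, hf, hfo⟩ := hu (o := fun x y => o (Sum.inl x) (Sum.inl y))
      (fun x y h => ho _ _ (by simpa using h))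
      fun x _ y _ z _ => ht (Sum.inl x) trivial (Sum.inl y) trivial (Sum.inl z) trivial
    obtain ⟨d', g, hg, hgo⟩ := hd (o := fun x y => o (Sum.inr x) (Sum.inr y))
      (fun x y h => ho _ _ (by simpa using h))
      fun x _ y _ z _ => ht (Sum.inr x) trivial (Sum.inr y) trivial (Sum.inr z) trivial
    obtain ⟨x₀⟩ := instNonemptyLeaf u
    obtain ⟨y₀⟩ := instNonemptyLeaf d
    -- All pairs separated at the root are oriented alike, which decides the order of the two
    -- subtrees without transitivity of `o`.
    have hlr : ∀ x y, o (Sum.inl x) (Sum.inr y) ↔ o (Sum.inl x₀) (Sum.inr y₀) := fun x y => by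
      rw [ht (Sum.inl x) trivial (Sum.inl x₀) trivial (Sum.inr y) trivial trivial,
        ho (Sum.inl x₀) (Sum.inr y) (by simp), ho (Sum.inl x₀) (Sum.inr y₀) (by simp),
        ht (Sum.inr y) trivial (Sum.inr y₀) trivial (Sum.inl x₀) trivial trivial]
    by_cases h₀ : o (Sum.inl x₀) (Sum.inr y₀)
    · refine ⟨node u' d', Equiv.sumCongr f g, isIso_sumCongr hf hg, ?_⟩
      rintro (x | x) (y | y) hxy
      · exact hfo x y (by simpa using hxy)
      · exact iff_of_true trivial ((hlr x y).2 h₀)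
      · exact iff_of_false id ((ho _ _ (by simp)).1 ((hlr y x).2 h₀))
      · exact hgo x y (by simpa using hxy)
    · refine ⟨node d' u', (Equiv.sumCongr f g).trans (Equiv.sumComm _ _),
        (isIso_sumCongr hf hg).trans (isIso_sumComm u' d'), ?_⟩
      rintro (x | x) (y | y) hxy
      · exact hfo x y (by simpa using hxy)
      · exact iff_of_false id fun h => h₀ ((hlr x y).1 h)
      · exact iff_of_true trivial ((ho _ _ (by simp)).2 fun h => h₀ ((hlr y x).1 h))
      · exact hgo x y (by simpa using hxy)

/-! ### Induced trees -/

theorem Induced.injective {t t' : PlaneTree} {f : t'.Leaf → t.Leaf} (h : Induced t t' f) :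
    f.Injective := by
  induction h with
  | leaf => exact Function.injective_id
  | up d _ ih => exact Sum.inl_injective.comp ih
  | down u _ ih => exact Sum.inr_injective.comp ih
  | node _ _ hu hd => exact hu.sumMap hd

theorem Induced.triple_iff {t t' : PlaneTree} {f : t'.Leaf → t.Leaf} (h : Induced t t' f)
    (x y z : t'.Leaf) : t.Triple (f x) (f y) (f z) ↔ t'.Triple x y z := by
  induction h with
  | leaf => exact Iff.rfl
  | up d _ ih => exact ih x y z
  | down u _ ih => exact ih x y z
  | node _ _ hu hd =>
    rcases x with x | x <;> rcases y with y | y <;> rcases z with z | z <;> try exact Iff.rfl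
    exacts [hu x y z, hd x y z]

theorem exists_induced (t : PlaneTree) {E : Set t.Leaf} (hE : E.Nonempty) :
    ∃ (t' : PlaneTree) (f : t'.Leaf → t.Leaf), Induced t t' f ∧ Set.range f = E := by
  induction t with
  | leaf =>
    refine ⟨leaf, id, Induced.leaf, ?_⟩
    obtain ⟨x, hx⟩ := hE
    ext y
    simpa [Subsingleton.elim (α := Unit) y x] using hx
  | node u d hu hd =>
    have hE' : E = Sum.inl '' (Sum.inl ⁻¹' E) ∪ Sum.inr '' (Sum.inr ⁻¹' E) :=
      (Set.image_preimage_inl_union_image_preimage_inr E).symm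
    rcases (Sum.inl ⁻¹' E).eq_empty_or_nonempty with h₁ | h₁ <;>
      rcases (Sum.inr ⁻¹' E).eq_empty_or_nonempty with h₂ | h₂
    · rw [h₁, h₂] at hE'
      simp [hE'] at hE
    · obtain ⟨t', f, hf, hr⟩ := hd h₂
      refine ⟨t', _, Induced.down u hf, ?_⟩
      rw [hE', h₁, ← hr, Set.image_empty, Set.empty_union, ← Set.range_comp]; rfl
    · obtain ⟨t', f, hf, hr⟩ := hu h₁
      refine ⟨t', _, Induced.up d hf, ?_⟩
      rw [hE', h₂, ← hr, Set.image_empty, Set.union_empty, ← Set.range_comp]; rfl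
    · obtain ⟨u', f, hf, hr⟩ := hu h₁
      obtain ⟨d', g, hg, hr'⟩ := hd h₂
      refine ⟨node u' d', _, Induced.node hf hg, ?_⟩
      rw [hE', ← hr, ← hr', ← Set.range_comp, ← Set.range_comp]
      ext x
      simp [Set.mem_range, Sum.exists]

end PlaneTree

open PlaneTree

/-! ### Layouts as two trees on the matching edges -/

namespace Layout

/-- The right tree of a layout, as a tree on the matching edges. -/
def rightTriple (Λ : Layout) (x y z : Λ.L.Leaf) : Prop := Λ.R.Triple (Λ.σ x) (Λ.σ y) (Λ.σ z)

theorem isTreeRel_rightTriple (Λ : Layout) : IsTreeRel Λ.rightTriple :=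
  Λ.R.isTreeRel_triple.comp Λ.σ.injective

/-- The matching edges can be drawn without crossings after switches. -/
def Drawable (Λ : Layout) : Prop := HasCommonOrder Λ.L.Triple Λ.rightTriple Set.univ

/-- Two layouts are isomorphic if they differ only by the plane embeddings of their trees. -/
def Isomorphic (Λ Λ' : Layout) : Prop :=
  ∃ (f : Λ.L.Leaf ≃ Λ'.L.Leaf) (g : Λ.R.Leaf ≃ Λ'.R.Leaf),
    IsIso f ∧ IsIso g ∧ ∀ e, g (Λ.σ e) = Λ'.σ (f e)

theorem Isomorphic.refl (Λ : Layout) : Λ.Isomorphic Λ :=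
  ⟨Equiv.refl _, Equiv.refl _, IsIso.refl _, IsIso.refl _, fun _ => rfl⟩

theorem Isomorphic.symm {Λ Λ' : Layout} (h : Λ.Isomorphic Λ') : Λ'.Isomorphic Λ := by
  obtain ⟨f, g, hf, hg, h⟩ := h
  refine ⟨f.symm, g.symm, hf.symm, hg.symm, fun e => ?_⟩
  rw [Equiv.symm_apply_eq, h, Equiv.apply_symm_apply]

theorem Isomorphic.trans {Λ Λ' Λ'' : Layout} (h : Λ.Isomorphic Λ') (h' : Λ'.Isomorphic Λ'') :
    Λ.Isomorphic Λ'' := by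
  obtain ⟨f, g, hf, hg, h⟩ := h
  obtain ⟨f', g', hf', hg', h'⟩ := h'
  exact ⟨f.trans f', g.trans g', hf.trans hf', hg.trans hg', fun e => by simp [h, h']⟩

theorem Switch.isomorphic {Λ Λ' : Layout} (h : Switch Λ Λ') : Λ.Isomorphic Λ' := by
  cases h with
  | left R σ h => exact ⟨_, Equiv.refl _, h.isIso, IsIso.refl _, fun e => by simp⟩
  | right L σ h => exact ⟨Equiv.refl _, _, IsIso.refl _, h.isIso, fun e => by simp⟩

theorem Isomorphic.drawable {Λ Λ' : Layout} (h : Λ.Isomorphic Λ') (hΛ' : Λ'.Drawable) :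
    Λ.Drawable := by
  obtain ⟨f, g, hf, hg, h⟩ := h
  refine HasCommonOrder.comap f.injective hf (fun x y z => ?_) hΛ'
  rw [rightTriple, ← h, ← h, ← h]
  exact hg _ _ _

theorem Induces.drawable {Λ Λ' : Layout} {E : Set Λ.L.Leaf} (h : Λ.Induces E Λ')
    (hΛ : Λ.Drawable) : Λ'.Drawable := by
  obtain ⟨f, g, hf, hg, h, -⟩ := h
  refine HasCommonOrder.comap hf.injective hf.triple_iff (fun x y z => ?_) hΛ
  rw [rightTriple, h, h, h]
  exact hg.triple_iff _ _ _

theorem Induces.isomorphic {Λ Λ' : Layout} (h : Λ.Induces Set.univ Λ') : Λ'.Isomorphic Λ := by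
  obtain ⟨f, g, hf, hg, h, hr⟩ := h
  have hfs : f.Surjective := Set.range_eq_univ.1 hr
  have hgs : g.Surjective := fun y => by
    obtain ⟨x, hx⟩ := hfs (Λ.σ.symm y)
    exact ⟨Λ'.σ x, by rw [← h, hx, Equiv.apply_symm_apply]⟩
  exact ⟨Equiv.ofBijective f ⟨hf.injective, hfs⟩, Equiv.ofBijective g ⟨hg.injective, hgs⟩,
    hf.triple_iff, hg.triple_iff, fun e => (h e).symm⟩

theorem exists_induces (Λ : Layout) {E : Set Λ.L.Leaf} (hE : E.Nonempty) :
    ∃ Λ', Λ.Induces E Λ' := by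
  obtain ⟨L', f, hf, hfr⟩ := Λ.L.exists_induced hE
  obtain ⟨R', g, hg, hgr⟩ := Λ.R.exists_induced (hE.image Λ.σ)
  have hex : ∀ e, ∃ e', g e' = Λ.σ (f e) := fun e => by
    have : Λ.σ (f e) ∈ Set.range g := hgr ▸ Set.mem_image_of_mem _ (hfr ▸ Set.mem_range_self e)
    exact this
  choose k hk using hex
  have hinj : k.Injective := fun x y hxy => hf.injective (Λ.σ.injective (by rw [← hk, ← hk, hxy]))
  have hsurj : k.Surjective := fun y => by
    obtain ⟨x, hx, hxy⟩ : g y ∈ Λ.σ '' E := hgr ▸ Set.mem_range_self y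
    obtain ⟨e, rfl⟩ : x ∈ Set.range f := hfr ▸ hx
    exact ⟨e, hg.injective (by rw [hk, hxy])⟩
  exact ⟨⟨L', R', Equiv.ofBijective k ⟨hinj, hsurj⟩⟩, f, g, hf, hg, fun e => (hk e).symm, hfr⟩

end Layout

/-! ### Equivalence and planarity of tanglegrams -/

namespace Tanglegram

theorem mk_eq_of_switches_left {L L' : PlaneTree} {f : L.Leaf ≃ L'.Leaf} (h : Switches L L' f)
    (R : PlaneTree) (σ : L.Leaf ≃ R.Leaf) : mk ⟨L, R, σ⟩ = mk ⟨L', R, f.symm.trans σ⟩ := by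
  induction h with
  | refl => rfl
  | step _ hg ih => exact ih.trans (Quot.sound (Layout.Switch.left R _ hg))

theorem mk_eq_of_switches_right (L : PlaneTree) {R R' : PlaneTree} {f : R.Leaf ≃ R'.Leaf}
    (h : Switches R R' f) (σ : L.Leaf ≃ R.Leaf) : mk ⟨L, R, σ⟩ = mk ⟨L, R', σ.trans f⟩ := by
  induction h with
  | refl => rfl
  | step _ hg ih => exact ih.trans (Quot.sound (Layout.Switch.right L _ hg))

theorem mk_eq_mk_iff {Λ Λ' : Layout} : mk Λ = mk Λ' ↔ Λ.Isomorphic Λ' := by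
  constructor
  · intro h
    replace h := Quot.eqvGen_exact h
    induction h with
    | rel _ _ h => exact h.isomorphic
    | refl => exact Layout.Isomorphic.refl _
    | symm _ _ _ ih => exact ih.symm
    | trans _ _ _ _ _ ih ih' => exact ih.trans ih'
  · rintro ⟨f, g, hf, hg, h⟩
    obtain ⟨L, R, σ⟩ := Λ
    obtain ⟨L', R', σ'⟩ := Λ'
    rw [mk_eq_of_switches_left hf.switches, mk_eq_of_switches_right _ hg.switches]
    congr 2
    ext e
    simp [h]

/-- Without crossings the vertical orders on the two lines agree and form a common order.
Conversely, a common order is realised by an embedding of each tree separately, and the two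
embeddings fit together without crossings. -/
theorem isPlanar_mk_iff {Λ : Layout} : (mk Λ).IsPlanar ↔ Λ.Drawable := by
  constructor
  · rintro ⟨Λ', h, hΛ'⟩
    refine (mk_eq_mk_iff.1 h).symm.drawable ⟨Λ'.L.Above, fun x _ y _ => Λ'.L.above_iff_not_above,
      Λ'.L.orients_above, ?_⟩
    have hLR : ∀ x y, x ≠ y → (Λ'.L.Above x y ↔ Λ'.R.Above (Λ'.σ x) (Λ'.σ y)) := fun x y hxy => by
      have h1 := hΛ' x y
      have h2 := Λ'.L.above_iff_not_above hxy
      have h3 := Λ'.R.above_iff_not_above (Λ'.σ.injective.ne hxy)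
      unfold Layout.Cross at h1
      tauto
    intro x _ y _ z _ hT
    rw [hLR x z (Λ'.isTreeRel_rightTriple.ne_right hT),
      hLR y z (Λ'.isTreeRel_rightTriple.ne_right' hT)]
    exact Λ'.R.orients_above _ trivial _ trivial _ trivial hT
  · rintro ⟨o, h1, h2, h3⟩
    obtain ⟨L, f, hf, hfo⟩ := Λ.L.exists_isIso_above (fun x y => h1 x trivial y trivial) h2
    obtain ⟨R, g, hg, hgo⟩ := Λ.R.exists_isIso_above
      (o := fun x y => o (Λ.σ.symm x) (Λ.σ.symm y))
      (fun x y hxy => h1 _ trivial _ trivial (Λ.σ.symm.injective.ne hxy))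
      fun x _ y _ z _ hT => h3 _ trivial _ trivial _ trivial (by simpa [Layout.rightTriple] using hT)
    refine ⟨⟨L, R, f.symm.trans (Λ.σ.trans g)⟩, ?_, ?_⟩
    · exact mk_eq_mk_iff.2 (Layout.Isomorphic.symm ⟨f, g, hf, hg, fun e => by simp⟩)
    · have hL : ∀ e e', L.Above e e' → o (f.symm e) (f.symm e') := fun e e' h => by
        rw [← hfo _ _ (f.symm.injective.ne (L.ne_of_above h))]; simpa using h
      have hR : ∀ e e', R.Above (g (Λ.σ (f.symm e))) (g (Λ.σ (f.symm e'))) →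
          o (f.symm e) (f.symm e') := fun e e' h => by
        have := (hgo _ _ fun h' => R.ne_of_above h (congrArg g h')).1 h
        simpa using this
      rintro e e' (⟨ha, hb⟩ | ⟨ha, hb⟩)
      · exact (h1 _ trivial _ trivial (f.symm.injective.ne (L.ne_of_above ha))).1 (hL _ _ ha)
          (hR _ _ hb)
      · exact (h1 _ trivial _ trivial (f.symm.injective.ne (L.ne_of_above ha))).1 (hL _ _ ha)
          (hR _ _ hb)

/-! ### Recognising No. 6 and No. 13 -/

/-- The map from the leaves of the caterpillar that lists four given elements. -/
def caterpillarMap {X : Type*} (a b c d : X) : caterpillar.Leaf → X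
  | Sum.inl (Sum.inl (Sum.inl _)) => a
  | Sum.inl (Sum.inl (Sum.inr _)) => b
  | Sum.inl (Sum.inr _) => c
  | Sum.inr _ => d

/-- The map from the leaves of the complete binary tree that lists four given elements. -/
def balancedMap {X : Type*} (a b c d : X) : balanced.Leaf → X
  | Sum.inl (Sum.inl _) => a
  | Sum.inl (Sum.inr _) => b
  | Sum.inr (Sum.inl _) => c
  | Sum.inr (Sum.inr _) => d

theorem triple_caterpillarMap {X : Type*} {T : X → X → X → Prop} (h : IsTreeRel T) {a b c d : X}
    (hab : a ≠ b) (abc : T a b c) (acd : T a c d) (x y z : caterpillar.Leaf) :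
    caterpillar.Triple x y z → T (caterpillarMap a b c d x) (caterpillarMap a b c d y)
      (caterpillarMap a b c d z) := by
  have abd : T a b d := (h.four d abc).resolve_right (h.excl acd)
  have bcd : T b c d := h.trans (h.symm abd) acd
  have hac := h.ne_right abc
  have hbc := h.ne_right' abc
  have had := h.ne_right acd
  have hcd := h.ne_right' acd
  have hbd := h.ne_right' abd
  rcases x with ((x | x) | x) | x <;> rcases y with ((y | y) | y) | y <;>
    rcases z with ((z | z) | z) | z <;>
    simp only [caterpillar, Triple, caterpillarMap, false_imp_iff, true_imp_iff] <;>
    first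
    | exact h.refl (by first | assumption | exact Ne.symm (by assumption))
    | assumption
    | exact h.symm (by assumption)

theorem triple_balancedMap {X : Type*} {T : X → X → X → Prop} (h : IsTreeRel T) {a b c d : X}
    (hab : a ≠ b) (hcd : c ≠ d)
    (abc : T a b c) (cda : T c d a) (x y z : balanced.Leaf) :
    balanced.Triple x y z → T (balancedMap a b c d x) (balancedMap a b c d y)
      (balancedMap a b c d z) := by
  have abd : T a b d := (h.four d abc).resolve_right fun h' => h.excl (h.symm cda) (h.symm h')
  have cdb : T c d b := (h.four b cda).resolve_right fun h' => h.excl (h.symm abc) (h.symm h')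
  have hac := h.ne_right abc
  have hbc := h.ne_right' abc
  have had := h.ne_right abd
  have hbd := h.ne_right' abd
  rcases x with (x | x) | (x | x) <;> rcases y with (y | y) | (y | y) <;>
    rcases z with (z | z) | (z | z) <;>
    simp only [balanced, Triple, balancedMap, false_imp_iff, true_imp_iff] <;>
    first
    | exact h.refl (by first | assumption | exact Ne.symm (by assumption))
    | assumption
    | exact h.symm (by assumption)

/-- Degenerate triples `x x y` encode distinctness, so preserving triples includes preserving
inequality. -/
theorem injective_of_triple {t : PlaneTree} {X : Type*} {T : X → X → X → Prop} (h : IsTreeRel T)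
    {f : t.Leaf → X} (hf : ∀ x y z, t.Triple x y z → T (f x) (f y) (f z)) : f.Injective := by
  intro x y hxy
  by_contra hne
  exact h.ne_right (hf _ _ _ (t.isTreeRel_triple.refl hne)) hxy

/-- The layout that defines No. 6. -/
def no6Layout : Layout :=
  ⟨caterpillar, caterpillar,
    Equiv.swap (Sum.inl (Sum.inl (Sum.inr ())) : caterpillar.Leaf) (Sum.inr ())⟩

/-- The layout that defines No. 13. -/
def no13Layout : Layout :=
  ⟨balanced, balanced,
    Equiv.swap (Sum.inl (Sum.inr ()) : balanced.Leaf) (Sum.inr (Sum.inl ()))⟩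

theorem caterpillarConflict_no6Layout :
    CaterpillarConflict no6Layout.L.Triple no6Layout.rightTriple
      (Sum.inl (Sum.inl (Sum.inl ()))) (Sum.inl (Sum.inl (Sum.inr ()))) (Sum.inl (Sum.inr ()))
      (Sum.inr ()) :=
  ⟨trivial, trivial, trivial, trivial⟩

theorem balancedConflict_no13Layout :
    BalancedConflict no13Layout.L.Triple no13Layout.rightTriple
      (Sum.inl (Sum.inl ())) (Sum.inl (Sum.inr ())) (Sum.inr (Sum.inl ())) (Sum.inr (Sum.inr ())) :=
  ⟨trivial, trivial, trivial, trivial⟩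

theorem not_isPlanar_no6 : ¬ no6.IsPlanar := fun h =>
  caterpillarConflict_no6Layout.not_hasCommonOrder (isTreeRel_triple _)
    no6Layout.isTreeRel_rightTriple ((isPlanar_mk_iff (Λ := no6Layout)).1 h)

theorem not_isPlanar_no13 : ¬ no13.IsPlanar := fun h =>
  balancedConflict_no13Layout.not_hasCommonOrder (isTreeRel_triple _)
    no13Layout.isTreeRel_rightTriple ((isPlanar_mk_iff (Λ := no13Layout)).1 h)

/-- Sufficient condition for an isomorphism of layouts. -/
theorem isomorphic_of_triple {Λ Λ' : Layout} {f : Λ.L.Leaf → Λ'.L.Leaf} {g : Λ.R.Leaf → Λ'.L.Leaf}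
    (hf : ∀ x y z, Λ.L.Triple x y z → Λ'.L.Triple (f x) (f y) (f z))
    (hg : ∀ x y z, Λ.R.Triple x y z → Λ'.rightTriple (g x) (g y) (g z))
    (hsurj : f.Surjective) (hfg : ∀ e, g (Λ.σ e) = f e) : Λ.Isomorphic Λ' := by
  have hfi := injective_of_triple Λ'.L.isTreeRel_triple hf
  have hgi := injective_of_triple Λ'.isTreeRel_rightTriple hg
  have hgs : g.Surjective := fun y => by
    obtain ⟨x, rfl⟩ := hsurj y
    exact ⟨Λ.σ x, hfg x⟩
  refine ⟨Equiv.ofBijective f ⟨hfi, hsurj⟩, (Equiv.ofBijective g ⟨hgi, hgs⟩).trans Λ'.σ,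
    Λ.L.isTreeRel_triple.iff_of_imp Λ'.L.isTreeRel_triple hf,
    Λ.R.isTreeRel_triple.iff_of_imp Λ'.isTreeRel_rightTriple hg, fun e => congrArg Λ'.σ (hfg e)⟩

theorem isomorphic_of_caterpillarConflict {Λ : Layout} {a b c d : Λ.L.Leaf}
    (h : CaterpillarConflict Λ.L.Triple Λ.rightTriple a b c d)
    (hall : ∀ e, e = a ∨ e = b ∨ e = c ∨ e = d) : no6Layout.Isomorphic Λ := by
  obtain ⟨abc, acd, adc, acb⟩ := h
  have hL := Λ.L.isTreeRel_triple
  have hR := Λ.isTreeRel_rightTriple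
  refine isomorphic_of_triple (f := caterpillarMap a b c d) (g := caterpillarMap a d c b)
    (triple_caterpillarMap hL (hR.ne_right acb) abc acd)
    (triple_caterpillarMap hR (hL.ne_right acd) adc acb) (fun e => ?_) ?_
  · rcases hall e with rfl | rfl | rfl | rfl
    exacts [⟨Sum.inl (Sum.inl (Sum.inl ())), rfl⟩, ⟨Sum.inl (Sum.inl (Sum.inr ())), rfl⟩,
      ⟨Sum.inl (Sum.inr ()), rfl⟩, ⟨Sum.inr (), rfl⟩]
  · rintro (((⟨⟩ | ⟨⟩) | ⟨⟩) | ⟨⟩) <;> rfl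

theorem isomorphic_of_balancedConflict {Λ : Layout} {a b c d : Λ.L.Leaf}
    (h : BalancedConflict Λ.L.Triple Λ.rightTriple a b c d)
    (hall : ∀ e, e = a ∨ e = b ∨ e = c ∨ e = d) : no13Layout.Isomorphic Λ := by
  obtain ⟨abc, cda, acb, bda⟩ := h
  have hL := Λ.L.isTreeRel_triple
  have hR := Λ.isTreeRel_rightTriple
  have hcd : c ≠ d := by rintro rfl; exact hR.excl (hR.symm acb) (hR.symm bda)
  have hbd : b ≠ d := by rintro rfl; exact hL.excl (hL.symm abc) (hL.symm cda)
  refine isomorphic_of_triple (f := balancedMap a b c d) (g := balancedMap a c b d)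
    (triple_balancedMap hL (hR.ne_right acb) hcd abc cda)
    (triple_balancedMap hR (hL.ne_right abc) hbd acb bda) (fun e => ?_) ?_
  · rcases hall e with rfl | rfl | rfl | rfl
    exacts [⟨Sum.inl (Sum.inl ()), rfl⟩, ⟨Sum.inl (Sum.inr ()), rfl⟩,
      ⟨Sum.inr (Sum.inl ()), rfl⟩, ⟨Sum.inr (Sum.inr ()), rfl⟩]
  · rintro ((⟨⟩ | ⟨⟩) | (⟨⟩ | ⟨⟩)) <;> rfl

/-! ### Criticality -/

/-- A layout that cannot be drawn without crossings induces No. 6 or No. 13. -/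
theorem exists_induces_of_not_drawable {Λ : Layout} (h : ¬ Λ.Drawable) :
    ∃ (E : Set Λ.L.Leaf) (Λ' : Layout), Λ.Induces E Λ' ∧ (mk Λ' = no6 ∨ mk Λ' = no13) := by
  obtain ⟨a, b, c, d, hconf⟩ := (hasCommonOrder_or_conflict Λ.L.isTreeRel_triple
    Λ.isTreeRel_rightTriple Set.univ).resolve_left h
  obtain ⟨Λ', hΛ'⟩ := Λ.exists_induces (E := {a, b, c, d}) (by simp)
  refine ⟨_, Λ', hΛ', ?_⟩
  obtain ⟨f, g, hf, hg, hfg, hr⟩ := hΛ'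
  obtain ⟨a, rfl⟩ : a ∈ Set.range f := by rw [hr]; simp
  obtain ⟨b, rfl⟩ : b ∈ Set.range f := by rw [hr]; simp
  obtain ⟨c, rfl⟩ : c ∈ Set.range f := by rw [hr]; simp
  obtain ⟨d, rfl⟩ : d ∈ Set.range f := by rw [hr]; simp
  have hall : ∀ e, e = a ∨ e = b ∨ e = c ∨ e = d := fun e => by
    have : f e ∈ Set.range f := Set.mem_range_self e
    simpa [hr, hf.injective.eq_iff] using this
  have hL := hf.triple_iff
  have hR : ∀ x y z, Λ.rightTriple (f x) (f y) (f z) ↔ Λ'.rightTriple x y z := fun x y z => by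
    rw [Layout.rightTriple, hfg, hfg, hfg]; exact hg.triple_iff _ _ _
  rcases hconf with h | h
  · refine Or.inl (mk_eq_mk_iff.2 (isomorphic_of_caterpillarConflict ?_ hall).symm)
    simpa only [CaterpillarConflict, hL, hR] using h
  · refine Or.inr (mk_eq_mk_iff.2 (isomorphic_of_balancedConflict ?_ hall).symm)
    simpa only [BalancedConflict, hL, hR] using h

theorem four_le_card_of_not_drawable {Λ : Layout} (h : ¬ Λ.Drawable) :
    4 ≤ Nat.card Λ.L.Leaf := by
  obtain ⟨E, Λ', ⟨f, g, hf, -⟩, hΛ'⟩ := exists_induces_of_not_drawable h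
  refine le_trans ?_ (Nat.card_le_card_of_injective f hf.injective)
  rcases hΛ' with h | h
  · obtain ⟨φ, -⟩ := mk_eq_mk_iff.1 (h : mk Λ' = mk no6Layout)
    rw [Nat.card_congr φ]
    simp [caterpillar]
  · obtain ⟨φ, -⟩ := mk_eq_mk_iff.1 (h : mk Λ' = mk no13Layout)
    rw [Nat.card_congr φ]
    simp [balanced]

/-- A proper set of edges has at most three elements, too few for a non-planar layout. -/
theorem isCrossingCritical_mk {Λ₀ : Layout} (h : ¬ (mk Λ₀).IsPlanar)
    (hcard : Nat.card Λ₀.L.Leaf = 4) : (mk Λ₀).IsCrossingCritical := by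
  refine ⟨h, ?_⟩
  rintro _ ⟨Λ, E, Λ', hΛ, ⟨f, g, hf, -, -, hr⟩, hE, rfl⟩
  rw [isPlanar_mk_iff]
  by_contra hΛ'
  obtain ⟨φ, -⟩ := mk_eq_mk_iff.1 hΛ
  refine hE (hr ▸ Set.range_eq_univ.2 (hf.injective.bijective_of_nat_card_le ?_).2)
  rw [Nat.card_congr φ, hcard]
  exact four_le_card_of_not_drawable hΛ'

theorem IsInducedSub.isPlanar {S T : Tanglegram} (h : S.IsInducedSub T) (hT : T.IsPlanar) :
    S.IsPlanar := by
  obtain ⟨Λ, E, Λ', rfl, hE, rfl⟩ := h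
  rw [isPlanar_mk_iff] at hT ⊢
  exact hE.drawable hT

end Tanglegram

theorem theorem1 :
    (∀ T : Tanglegram,
      T.IsCrossingCritical ↔ T = Tanglegram.no6 ∨ T = Tanglegram.no13) ∧
    (∀ T : Tanglegram,
      ¬ T.IsPlanar ↔
        Tanglegram.no6.IsInducedSub T ∨ Tanglegram.no13.IsInducedSub T) := by
  refine ⟨fun T => ⟨?_, ?_⟩, fun T => ⟨fun hT => ?_, ?_⟩⟩
  · induction T using Quot.ind with
    | mk Λ =>
      rintro ⟨hT, hmin⟩
      obtain ⟨E, Λ', hE, hΛ'⟩ :=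
        Tanglegram.exists_induces_of_not_drawable fun h => hT (Tanglegram.isPlanar_mk_iff.2 h)
      by_cases hE' : E = Set.univ
      · subst hE'
        rwa [Tanglegram.mk_eq_mk_iff.2 hE.isomorphic] at hΛ'
      · have hpl := hmin (Tanglegram.mk Λ') ⟨Λ, E, Λ', rfl, hE, hE', rfl⟩
        rcases hΛ' with h | h <;> rw [h] at hpl
        exacts [absurd hpl Tanglegram.not_isPlanar_no6, absurd hpl Tanglegram.not_isPlanar_no13]
  · rintro (rfl | rfl)
    · exact Tanglegram.isCrossingCritical_mk (Λ₀ := Tanglegram.no6Layout)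
        Tanglegram.not_isPlanar_no6 (by simp [Tanglegram.no6Layout, Tanglegram.caterpillar])
    · exact Tanglegram.isCrossingCritical_mk (Λ₀ := Tanglegram.no13Layout)
        Tanglegram.not_isPlanar_no13 (by simp [Tanglegram.no13Layout, Tanglegram.balanced])
  · induction T using Quot.ind with
    | mk Λ =>
      obtain ⟨E, Λ', hE, hΛ'⟩ :=
        Tanglegram.exists_induces_of_not_drawable fun h => hT (Tanglegram.isPlanar_mk_iff.2 h)
      exact hΛ'.imp (fun h => ⟨Λ, E, Λ', rfl, hE, h⟩) fun h => ⟨Λ, E, Λ', rfl, hE, h⟩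
  · rintro (h | h) hT
    exacts [Tanglegram.not_isPlanar_no6 (h.isPlanar hT),
      Tanglegram.not_isPlanar_no13 (h.isPlanar hT)]
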